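/- \textbf{Model.} Consider the Gaussian crossed effect model with two factors with $I$ levels each: for $n=1,\dots,N$, $y_n\sim N(a^{(0)}+a^{(1)}_{i_1[n]}+a^{(2)}_{i_2[n]},\tau^{-1})$ independently, with independent priors $a^{(k)}_i\sim N(0,\tau_k^{-1})$ ($k=1,2$, $1\le i\le I$) and $a^{(0)}\sim N(\mu_{pr},T_{pr}^{-1})$, where $\tau,\tau_1,\tau_2>0$ and $T_{pr}\ge 0$ ($T_{pr}=0$ meaning a flat prior). Let $n_{ij}$ be the number of observations with $i_1[n]=i$ and $i_2[n]=j$, $p=2I$ the number of factor levels, and $\bar n=2N/p$. Let $Q$ be the posterior precision matrix of $\theta=(a^{(1)}_1,\dots,a^{(1)}_I,a^{(2)}_1,\dots,a^{(2)}_I,a^{(0)})$, in this order, and $M=2I+1$. \textbf{Sparse linear algebra.} Let $G_Q$ be the graph on $\{1,\dots,M\}$ with an edge between $i\ne j$ iff $Q_{ij}\neq0$, and $n_Q$ the number of non-zero entries of the lower triangular part of $Q$ (with the diagonal). For $m\le j$ the entry $L_{jm}$ of the Cholesky factor is a potential non-zero if some path from $m$ to $j$ in $G_Q$ avoids $\{m+1,\dots,M\}\setminus\{j\}$;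 $n_L$ is the number of potential non-zeros. $Cost(SLA)$ is the number of flops used by the columnwise recursion $L_{mm}=(Q_{mm}-\sum_{\ell<m}L_{m\ell}^2)^{1/2}$, $L_{jm}=L_{mm}^{-1}(Q_{jm}-\sum_{\ell<m}L_{m\ell}L_{j\ell})$ ($j>m$), when entries that are not potential non-zeros are neither computed nor used. \textbf{Gibbs sampler.} One iteration of the collapsed Gibbs sampler redraws $(a^{(0)},a^{(1)})$ from its posterior law given $a^{(2)}$, and then $(a^{(0)},a^{(2)})$ from its posterior law given $a^{(1)}$. $Cost(Gibbs)$ is the cost per iteration times the relaxation time $(1-\rho)^{-1}$. Here $\rho$ is the $L^2$-rate of convergence with respect to the posterior law $\pi$, i.e. the infimum of the $r\geq 0$ such that $\|P^tf-\pi f\|_{L^2(\pi)}=O(r^t)$ for every $f\in L^2(\pi)$, $P$ being the transition operator of one iteration. The cost per iteration is the number of elementary operations (arithmetic operations, square roots, standard normal draws) of the implementation that, for each factor $k$ in turn, accumulates the counts and residual sums of the levels of factor $k$ in one pass through the data, draws $a^{(0)}$ from its (normal) posterior law given the effects of the other factor, and then draws each $a^{(k)}_i$ from its (normal) posterior law given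 $a^{(0)}$ and the effects of the other factor. \textbf{Design.} Given integers $d\ge2$ and $I\ge d+1$, let $n_{ij}=1$ for $1\le i\le I-1$ if (a) $i=j$, or (b) $i<j$ and $j-2$ is congruent modulo $I-1$ to an integer in $[d(i-1),di)$, or (c) $i>j$ and $j-1$ is congruent modulo $I-1$ to an integer in $[d(i-1),di)$; and $n_{ij}=0$ otherwise. Let $n_{Ij}=1$ if $\sum_{i=1}^{I-1}n_{ij}\le d$ and $n_{Ij}=0$ otherwise. \textbf{Claim.} There are absolute constants $c,C>0$ and, for all $\tau,\tau_1,\tau_2>0$, a constant $C_\gamma>0$ depending only on $(\tau,\tau_1,\tau_2)$ such that, for all $d\ge 2$, $I\ge d+1$, $T_{pr}\ge0$, $\mu_{pr}$, and all data with the above design: the design has balanced levels, i.e. every level of each factor has exactly $N/I$ observations, and $\bar n=d+1$; $$c\,p\bar n\le n_Q\le C\,p\bar n,\qquad c\,p^2\le n_L\le C\,p^2,\qquad c\,p^3\le Cost(SLA)\le C\,p^3;$$ the implementation above draws exactly from the conditional laws that define the sampler; and $$Cost(Gibbs)\le C_\gamma\,p\,\bar n^2 .$$ In particular, none of the constants depends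 on $N$ or $d$. -/

import Mathlib

open MeasureTheory ProbabilityTheory
open scoped ENNReal NNReal

noncomputable section

namespace CrossedEffects

/-! ### Computations with an operation counter -/

/-- A value together with the number of elementary operations spent on computing it. -/
structure Counted (α : Type) where
  val : α
  ops : ℕ

instance : Monad Counted where
  pure a := ⟨a, 0⟩
  bind x f := ⟨(f x.val).val, x.ops + (f x.val).ops⟩

/-- One elementary operation (an arithmetic operation, a square root, or one draw from `N(0,1)`)
with result `a`. -/
def op {α : Type} (a : α) : Counted α := ⟨a, 1⟩

/-! ### Sparse Cholesky factorization -/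

/-- The conditional independence graph of a Gaussian vector with precision matrix `Q`. -/
def condIndepGraph {M : ℕ} (Q : Matrix (Fin M) (Fin M) ℝ) : SimpleGraph (Fin M) :=
  SimpleGraph.fromRel fun i j => Q i j ≠ 0

/-- The future set `{m+1, …, M}` of `m`, with `j` left out, separates `m` from `j`: every walk from
`m` to `j` meets it. -/
def FutureSeparates {M : ℕ} (G : SimpleGraph (Fin M)) (m j : Fin M) : Prop :=
  ∀ w : G.Walk m j, ∃ v ∈ w.support, m < v ∧ v ≠ j

/-- The entry `L j m`, `m ≤ j`, of the Cholesky factor is a potential non-zero. -/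
def PotentialNonzero {M : ℕ} (G : SimpleGraph (Fin M)) (j m : Fin M) : Prop :=
  m ≤ j ∧ ¬ FutureSeparates G m j

open Classical in
/-- Number of potential non-zeros in the `m`-th column of the Cholesky factor. -/
def nLcol {M : ℕ} (Q : Matrix (Fin M) (Fin M) ℝ) (m : Fin M) : ℕ :=
  (Finset.univ.filter fun j => PotentialNonzero (condIndepGraph Q) j m).card

/-- Number of potential non-zeros in the Cholesky factor of `Q`. -/
def nL {M : ℕ} (Q : Matrix (Fin M) (Fin M) ℝ) : ℕ := ∑ m, nLcol Q m

open Classical in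
/-- Number of non-zeros in the lower triangular part (diagonal included) of `Q`. -/
def nQ {M : ℕ} (Q : Matrix (Fin M) (Fin M) ℝ) : ℕ :=
  (Finset.univ.filter fun x : Fin M × Fin M => x.2 ≤ x.1 ∧ Q x.1 x.2 ≠ 0).card

open Classical in
/-- Computation of the entry `L j m` (`m ≤ j`) from the earlier columns and, if `m < j`, from
`L m m`:
`L m m = √(Q m m - ∑ ℓ < m, L m ℓ ^ 2)` and `L j m = (Q j m - ∑ ℓ < m, L m ℓ * L j ℓ) / L m m`.
Products with an entry that is not a potential non-zero are skipped. -/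
def choleskyEntry {M : ℕ} (Q : Matrix (Fin M) (Fin M) ℝ) (L : Matrix (Fin M) (Fin M) ℝ)
    (j m : Fin M) : Counted ℝ := do
  let G := condIndepGraph Q
  let terms := (List.finRange M).filter fun l =>
    decide (l < m ∧ PotentialNonzero G m l ∧ PotentialNonzero G j l)
  let s ← terms.foldlM (fun (acc : ℝ) l => do
    let t ← op (L m l * L j l)
    op (acc - t)) (Q j m)
  if j = m then op (Real.sqrt s) else op (s / L m m)

open Classical in
/-- Column `m`: the potentially non-zero entries are computed from the diagonal downwards. -/
def choleskyColumn {M : ℕ} (Q : Matrix (Fin M) (Fin M) ℝ) (L : Matrix (Fin M) (Fin M) ℝ)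
    (m : Fin M) : Counted (Matrix (Fin M) (Fin M) ℝ) :=
  ((List.finRange M).filter fun j => decide (PotentialNonzero (condIndepGraph Q) j m)).foldlM
    (fun (A : Matrix (Fin M) (Fin M) ℝ) j => do
      let x ← choleskyEntry Q A j m
      pure (A.updateRow j (Function.update (A j) m x))) L

/-- The columnwise sparse Cholesky factorization. -/
def cholesky {M : ℕ} (Q : Matrix (Fin M) (Fin M) ℝ) : Counted (Matrix (Fin M) (Fin M) ℝ) :=
  (List.finRange M).foldlM (fun L m => choleskyColumn Q L m) 0

/-- The cost of sampling by sparse linear algebra: the number of flops of the sparse Cholesky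
factorization. -/
def costSLA {M : ℕ} (Q : Matrix (Fin M) (Fin M) ℝ) : ℕ := (cholesky Q).ops

/-! ### Rate of convergence and relaxation time of a Markov chain -/

/-- `P ^ t f`, where `P f x = ∫ f dP(x, ·)`. -/
def kernelIter {X : Type} [MeasurableSpace X] (P : Kernel X X) (f : X → ℝ) (t : ℕ) : X → ℝ :=
  (fun (g : X → ℝ) x => ∫ y, g y ∂(P x))^[t] f

/-- The `L²(π)`-rate of convergence of the chain with transition kernel `P`: the infimum of the `r`
such that `‖P ^ t f - π f‖ = O(r ^ t)` in `L²(π)` for every `f ∈ L²(π)`. -/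
def l2Rate {X : Type} [MeasurableSpace X] (P : Kernel X X) (π : Measure X) : ℝ≥0∞ :=
  sInf {ρ : ℝ≥0∞ | ∃ r : ℝ≥0, ρ = r ∧ ∀ f : X → ℝ, MemLp f 2 π → ∃ C : ℝ≥0, ∀ t : ℕ,
    eLpNorm (fun x => kernelIter P f t x - ∫ y, f y ∂π) 2 π ≤ (C : ℝ≥0∞) * (r : ℝ≥0∞) ^ t}

/-- The relaxation time `1 / (1 - rate)`; it is `∞` if the rate is (at least) `1`. -/
def relaxationTime {X : Type} [MeasurableSpace X] (P : Kernel X X) (π : Measure X) : ℝ≥0∞ :=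
  (1 - l2Rate P π)⁻¹

/-! ### Gaussian crossed effect models with two factors -/

/-- Data and parameters of the Gaussian crossed effect model with two factors (indexed by `Fin 2`),
`I` levels per factor and `N` real observations:
`y n ∼ N(a⁽⁰⁾ + a⁽¹⁾_{i₁[n]} + a⁽²⁾_{i₂[n]}, 1/τ)`, `a⁽ᵏ⁾_i ∼ N(0, 1/τₖ)`, `a⁽⁰⁾ ∼ N(μpr, 1/tpr)`,
where `tpr = 0` stands for the flat prior. -/
structure Model (I N : ℕ) where
  /-- `lev k n` is the level of factor `k` in observation `n`. -/
  lev : Fin 2 → Fin N → Fin I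
  y : Fin N → ℝ
  /-- Precision of the observations. -/
  τ : ℝ
  /-- Prior precisions of the two factors. -/
  τf : Fin 2 → ℝ
  /-- Prior mean and precision of the global mean. -/
  μpr : ℝ
  tpr : ℝ

/-- The regression parameters `(a⁽⁰⁾, (a⁽ᵏ⁾)ₖ)`. -/
abbrev State (I : ℕ) : Type := ℝ × (Fin 2 → Fin I → ℝ)

namespace Model

variable {I N : ℕ}

/-- Number of observations at level `i` of the first and level `j` of the second factor. -/
def cooc (D : Model I N) (i j : Fin I) : ℕ :=
  (Finset.univ.filter fun n => D.lev 0 n = i ∧ D.lev 1 n = j).card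

/-- Number of observations at level `i` of factor `k`. -/
def occ (D : Model I N) (k : Fin 2) (i : Fin I) : ℕ :=
  (Finset.univ.filter fun n => D.lev k n = i).card

/-- Every level of every factor has the same number `N / I` of observations. -/
def BalancedLevels (D : Model I N) : Prop :=
  ∀ (k : Fin 2) (i : Fin I), (D.occ k i : ℝ) = N / I

/-- The number `p = I + I` of factor levels. -/
def p (_ : Model I N) : ℝ := 2 * I

/-- The average number `2 N / p` of observations per factor level. -/
def nbar (D : Model I N) : ℝ := 2 * N / D.p

/-- Design matrix: the linear predictor of observation `n` is `∑ v, X n v * θ v`. The column `none`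
belongs to `a⁽⁰⁾`, the column `some (k, i)` to level `i` of factor `k`. -/
def designMatrix (D : Model I N) : Matrix (Fin N) (Option (Fin 2 × Fin I)) ℝ :=
  fun n v => match v with
    | none => 1
    | some (k, i) => if D.lev k n = i then 1 else 0

/-- Prior precisions of the regression parameters. -/
def priorPrec (D : Model I N) : Option (Fin 2 × Fin I) → ℝ
  | none => D.tpr
  | some (k, _) => D.τf k

/-- The ordering `(a⁽¹⁾_1, …, a⁽¹⁾_I, a⁽²⁾_1, …, a⁽²⁾_I, a⁽⁰⁾)`. -/
def ordering (I : ℕ) : Fin (2 * I + 1) ≃ Option (Fin 2 × Fin I) :=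
  finSuccEquivLast.trans (Equiv.optionCongr finProdFinEquiv.symm)

/-- The posterior precision matrix, prior precision plus `τ Xᵀ X`, in the above ordering. -/
def precision (D : Model I N) : Matrix (Fin (2 * I + 1)) (Fin (2 * I + 1)) ℝ :=
  (Matrix.diagonal D.priorPrec + D.τ • (D.designMatrix.transpose * D.designMatrix)).submatrix
    (ordering I) (ordering I)

/-- Unnormalized posterior density (prior times likelihood). -/
def postWeight (D : Model I N) (θ : State I) : ℝ :=
  Real.exp (-(D.tpr * (θ.1 - D.μpr) ^ 2 + ∑ k, ∑ i, D.τf k * θ.2 k i ^ 2) / 2) *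
    ∏ n, Real.exp (-D.τ * (D.y n - (θ.1 + θ.2 0 (D.lev 0 n) + θ.2 1 (D.lev 1 n))) ^ 2 / 2)

/-- The posterior law of the regression parameters given the data and the precisions: the
normalization of the measure with Lebesgue density `postWeight`. -/
def posterior (D : Model I N) : Measure (State I) :=
  ProbabilityTheory.cond (volume.withDensity fun θ => ENNReal.ofReal (D.postWeight θ)) Set.univ

instance (D : Model I N) : IsFiniteMeasure D.posterior := by
  unfold posterior; infer_instance

/-- The state in which `(a⁽⁰⁾, a⁽ᵏ⁾)` is `u` and the effects of the other factor are `b`. -/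
def assemble (k : Fin 2) (u : ℝ × (Fin I → ℝ)) (b : Fin I → ℝ) : State I :=
  (u.1, fun l => if l = k then u.2 else b)

/-- One block update of the collapsed Gibbs sampler: `(a⁽⁰⁾, a⁽ᵏ⁾)` is redrawn from its posterior
law given the effects of the other factor `k.rev`, which are kept. -/
def blockKernel (D : Model I N) (k : Fin 2) : Kernel (State I) (State I) :=
  (((condDistrib (fun θ : State I => (θ.1, θ.2 k)) (fun θ : State I => θ.2 k.rev) D.posterior) ×ₖ
      Kernel.id).comap (fun θ : State I => θ.2 k.rev) (by fun_prop)).map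
    fun x => assemble k x.1 x.2

/-- One iteration of the collapsed Gibbs sampler: the blocks of the first and of the second factor
are updated in turn. -/
def gibbsKernel (D : Model I N) : Kernel (State I) (State I) :=
  D.blockKernel 1 ∘ₖ D.blockKernel 0

/-- The noise that one block update consumes. -/
abbrev Noise (I : ℕ) : Type := ℝ × (Fin I → ℝ)

/-- The law of independent standard normal variables. -/
def noiseLaw (I : ℕ) : Measure (Noise I) :=
  (gaussianReal 0 1).prod (Measure.pi fun _ => gaussianReal 0 1)

/-- Number of observations and sum of the residuals `y n - a⁽ˡ⁾_{iₗ[n]}`, `l = k.rev`, for each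
level of factor `k`. -/
def levelSums (D : Model I N) (k : Fin 2) (θ : State I) :
    Counted ((Fin I → ℝ) × (Fin I → ℝ)) :=
  (List.finRange N).foldlM (fun (cs : (Fin I → ℝ) × (Fin I → ℝ)) n => do
    let i := D.lev k n
    let c ← op (cs.1 i + 1)
    let r ← op (D.y n - θ.2 k.rev (D.lev k.rev n))
    let s ← op (cs.2 i + r)
    pure (Function.update cs.1 i c, Function.update cs.2 i s)) (0, 0)

/-- Precision and precision times mean of `a⁽⁰⁾` given the effects of the factor `k.rev`, from the
counts `c` and the residual sums `s`. -/
def globalParams (D : Model I N) (k : Fin 2) (c s : Fin I → ℝ) : Counted (ℝ × ℝ) := do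
  let h₀ ← op (D.tpr * D.μpr)
  (List.finRange I).foldlM (fun (ph : ℝ × ℝ) i => do
    let u ← op (D.τ * c i)
    let v ← op (D.τf k + u)
    let q ← op (D.τ * D.τf k)
    let w ← op (q / v)
    let wc ← op (w * c i)
    let P ← op (ph.1 + wc)
    let ws ← op (w * s i)
    let H ← op (ph.2 + ws)
    pure (P, H)) (D.tpr, h₀)

/-- A draw from `N(h / v, 1 / v)`, where `z` is a standard normal draw. -/
def normalDraw (h v z : ℝ) : Counted ℝ := do
  let m ← op (h / v)
  let g ← op z
  let sd ← op (Real.sqrt v)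
  let e ← op (g / sd)
  op (m + e)

/-- Independent draws of the effects of factor `k` given `a⁽⁰⁾ = a₀` and the other factor. -/
def levelDraws (D : Model I N) (k : Fin 2) (c s : Fin I → ℝ) (a₀ : ℝ) (z : Fin I → ℝ) :
    Counted (Fin I → ℝ) :=
  (List.finRange I).foldlM (fun (a : Fin I → ℝ) i => do
    let u ← op (D.τ * c i)
    let v ← op (D.τf k + u)
    let ca ← op (c i * a₀)
    let r ← op (s i - ca)
    let h ← op (D.τ * r)
    let x ← normalDraw h v (z i)
    pure (Function.update a i x)) 0

/-- Implementation of the block update of factor `k`: first `a⁽⁰⁾` is drawn given the effects of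
the other factor, then the effects of factor `k` given `a⁽⁰⁾` and the effects of the other factor. -/
def blockProgram (D : Model I N) (k : Fin 2) (θ : State I) (z : Noise I) :
    Counted (State I) := do
  let cs ← D.levelSums k θ
  let ph ← D.globalParams k cs.1 cs.2
  let a₀ ← normalDraw ph.2 ph.1 z.1
  let a ← D.levelDraws k cs.1 cs.2 a₀ z.2
  pure (assemble k (a₀, a) (θ.2 k.rev))

/-- Implementation of one iteration of the collapsed Gibbs sampler. -/
def gibbsProgram (D : Model I N) (θ : State I) (z : Noise I × Noise I) : Counted (State I) := do
  let θ' ← D.blockProgram 0 θ z.1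
  D.blockProgram 1 θ' z.2

/-- The block programs draw exactly from the conditional laws that define the sampler. -/
def ProgramExact (D : Model I N) : Prop :=
  ∀ k : Fin 2, ∀ᵐ θ ∂D.posterior,
    (noiseLaw I).map (fun z => (D.blockProgram k θ z).val) = D.blockKernel k θ

/-- Largest number of operations in one iteration of the collapsed Gibbs sampler. -/
def costPerIteration (D : Model I N) : ℝ≥0∞ :=
  ⨆ (θ : State I) (z : Noise I × Noise I), ((D.gibbsProgram θ z).ops : ℝ≥0∞)

/-- The cost of the Gibbs sampler: cost per iteration times relaxation time. -/
def costGibbs (D : Model I N) : ℝ≥0∞ :=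
  D.costPerIteration * relaxationTime D.gibbsKernel D.posterior

end Model

/-! ### The worst-case balanced levels design -/

/-- The rule for the rows other than the last one. Rows and columns are numbered from `0`; with
numbers from `1` the conditions read `i = j`, or `i < j` and `d(i-1) ≤ j-2 < di` mod `I-1`, or
`j < i` and `d(i-1) ≤ j-1 < di` mod `I-1`. -/
def RegularCell (d I i j : ℕ) : Prop :=
  i = j ∨
  (i < j ∧ ∃ r, d * i ≤ r ∧ r < d * (i + 1) ∧ r + 1 ≡ j [MOD (I - 1)]) ∨
  (j < i ∧ ∃ r, d * i ≤ r ∧ r < d * (i + 1) ∧ r ≡ j [MOD (I - 1)])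

open Classical in
/-- The counts of the worst-case design; the last row fills up the columns that contain at most `d`
observations in the other rows. -/
def worstDesign (d I : ℕ) (i j : Fin I) : ℕ :=
  if (i : ℕ) + 1 < I then
    (if RegularCell d I i j then 1 else 0)
  else
    (if ∑ i' : Fin I, (if (i' : ℕ) + 1 < I ∧ RegularCell d I i' j then 1 else 0) ≤ d
      then 1 else 0)

end CrossedEffects

end

namespace CrossedEffects

/-! ### Folds in the counting monad -/

/-! Levels are numbered from 0, and n = I - 1. Row i < n holds its diagonal cell and d further
cells, whose columns run through d consecutive residues mod n with the diagonal column skipped. The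
blocks of successive rows tile [0, nd), so each residue is hit d times. A column loses at most one
of these hits to the skipping, hence holds d or d + 1 cells. The last row repairs the deficit, and
double counting shows that it has d + 1 cells itself.

Sparse linear algebra is slow because the design hides a d-ary tree: row (j-1)/d meets both column j
and column (j-1)/d, its parent (`worstDesign_tree`). From a second-factor level m in the later half
one can climb to the root through smaller levels, then descend to the parent of any j > m, which is
still at most m because d ≥ 2. First-factor levels precede all second-factor levels in the ordering,
so such a path avoids the future of m except for j. Hence the trailing block of L, of order about
I/2, is completely dense (`potentialNonzero_of_le`); this forces order p² potential non-zeros and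
order p³ flops, while Q itself has only order N non-zeros. The matching upper bounds are those of
dense factorization.

The Gibbs sampler is fast by a coupling that needs no spectral information on the design. Completing
squares (`complete_squares`) gives the conditional laws explicitly, which proves exactness and
represents a block update as an affine map of the kept effects plus noise. With common noise,
Cauchy-Schwarz within each level and balance of the levels show that the update of factor k
contracts Euclidean distance by q_k = τc/(τ_k + τc), where c = d + 1 (`blockDraw_sub`). So iterates
of Lipschitz functions flatten at rate q_0 q_1, and the finite second moments of the posterior
effects turn this into L² decay on the dense set of smooth compactly supported functions.

To reach all of L², the transition operator is written as a product p₀p₁ of two conditional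
expectations. The symmetrized operator p₀p₁p₀, minus the projection on constants, is self-adjoint,
and for such operators a decay rate on a dense set bounds the norm (`norm_apply_le_of_dense_decay`,
`alternating_projections_decay`). The relaxation time is then at most 1/(1 - q_0) = 1 + τc/τ_1 =
O(n̄), τ_1 being the prior precision of the first factor, and one iteration costs O(N) = O(p n̄)
operations. -/

@[simp] lemma Counted.val_pure {α : Type} (a : α) : (pure a : Counted α).val = a := rfl

@[simp] lemma Counted.ops_pure {α : Type} (a : α) : (pure a : Counted α).ops = 0 := rfl

@[simp] lemma Counted.val_bind {α β : Type} (x : Counted α) (f : α → Counted β) :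
    (x >>= f).val = (f x.val).val := rfl

@[simp] lemma Counted.ops_bind {α β : Type} (x : Counted α) (f : α → Counted β) :
    (x >>= f).ops = x.ops + (f x.val).ops := rfl

@[simp] lemma val_op {α : Type} (a : α) : (op a).val = a := rfl

@[simp] lemma ops_op {α : Type} (a : α) : (op a).ops = 1 := rfl

lemma Counted.val_foldlM {α β : Type} (f : α → β → Counted α) (l : List β) (a : α) :
    (l.foldlM f a).val = l.foldl (fun a b => (f a b).val) a := by
  induction l generalizing a with
  | nil => rfl
  | cons b l ih => simp [List.foldlM_cons, ih]

lemma Counted.ops_foldlM {α β : Type} (f : α → β → Counted α) (g : β → ℕ)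
    (h : ∀ a b, (f a b).ops = g b) (l : List β) (a : α) :
    (l.foldlM f a).ops = (l.map g).sum := by
  induction l generalizing a with
  | nil => rfl
  | cons b l ih => simp [List.foldlM_cons, ih, h]

/-! ### Rows and columns of the design -/

-- The residue ρ of r mod n is sent to column ρ if ρ < i and to ρ + 1 otherwise: the increasing
-- bijection from {0, …, n-1} onto the columns other than i. The shifts by 1 in the two off-diagonal
-- conditions encode exactly this skipping.
open Classical in
lemma regularCell_row {d n i : ℕ} (hi : i < n) :
    (Finset.range (n + 1)).filter (fun j => RegularCell d (n + 1) i j) =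
      insert i ((Finset.range d).image fun t =>
        if (d * i + t) % n < i then (d * i + t) % n else (d * i + t) % n + 1) := by
  have hn : 0 < n := by omega
  ext j
  simp only [Finset.mem_filter, Finset.mem_range, Finset.mem_insert, Finset.mem_image,
    RegularCell, Nat.add_sub_cancel]
  constructor
  · rintro ⟨hj, h | ⟨hij, r, hr₁, hr₂, hr₃⟩ | ⟨hij, r, hr₁, hr₂, hr₃⟩⟩
    · exact Or.inl h.symm
    · refine Or.inr ⟨r - d * i, by rw [mul_add, mul_one] at hr₂; omega, ?_⟩
      have e : d * i + (r - d * i) = r := by omega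
      have h3 : r ≡ j - 1 [MOD n] := by
        apply Nat.ModEq.add_right_cancel' 1
        rwa [Nat.sub_add_cancel (by omega)]
      have h4 : r % n = j - 1 := by
        rw [h3, Nat.mod_eq_of_lt (by omega)]
      rw [e, h4, if_neg (by omega)]
      omega
    · refine Or.inr ⟨r - d * i, by rw [mul_add, mul_one] at hr₂; omega, ?_⟩
      have e : d * i + (r - d * i) = r := by omega
      have h4 : r % n = j := by
        rw [hr₃, Nat.mod_eq_of_lt (by omega)]
      rw [e, h4, if_pos (by omega)]
  · rintro (h | ⟨t, ht, rfl⟩)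
    · exact ⟨by omega, Or.inl h.symm⟩
    · have h1 := Nat.mod_lt (d * i + t) hn
      refine ⟨by split_ifs <;> omega, Or.inr ?_⟩
      split_ifs with h
      · exact Or.inr ⟨h, d * i + t, by omega, by rw [mul_add, mul_one]; omega,
          (Nat.mod_modEq _ _).symm⟩
      · exact Or.inl ⟨by omega, d * i + t, by omega, by rw [mul_add, mul_one]; omega,
          ((Nat.mod_modEq _ _).symm).add_right 1⟩

open Classical in
lemma card_regularCell_row {d n i : ℕ} (hdn : d ≤ n) (hi : i < n) :
    ((Finset.range (n + 1)).filter (fun j => RegularCell d (n + 1) i j)).card = d + 1 := by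
  have hn : 0 < n := by omega
  rw [regularCell_row hi, Finset.card_insert_of_notMem, Finset.card_image_of_injOn,
    Finset.card_range]
  · intro t ht t' ht' h
    simp only [Finset.coe_range, Set.mem_Iio] at ht ht'
    have h1 : (d * i + t) % n = (d * i + t') % n := by
      simp only at h
      split_ifs at h <;> omega
    have h2 : t ≡ t' [MOD n] := Nat.ModEq.add_left_cancel' (d * i) h1
    rwa [Nat.ModEq, Nat.mod_eq_of_lt (by omega), Nat.mod_eq_of_lt (by omega)] at h2
  · simp only [Finset.mem_image, not_exists, not_and]
    intro t _ h
    split_ifs at h <;> omega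

/-- Points at mutual distance at least n ≥ d lie in different blocks of length d. Rows can therefore
be counted through the parameter t of r = a + n t. -/
lemma add_mul_div_injOn {d n : ℕ} (a : ℕ) (hd : 0 < d) (hdn : d ≤ n) (s : Set ℕ) :
    Set.InjOn (fun t => (a + n * t) / d) s := by
  have key : ∀ t t', t < t' → (a + n * t) / d < (a + n * t') / d := by
    intro t t' h
    have h1 : (a + n * t) / d + 1 = (a + n * t + d) / d := by
      rw [Nat.add_div_right _ hd]
    have h2 : a + n * t + d ≤ a + n * t' := by
      have := Nat.mul_le_mul_left n (Nat.succ_le_of_lt h)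
      rw [Nat.mul_succ] at this
      omega
    have := Nat.div_le_div_right (c := d) h2
    omega
  intro t _ t' _ h
  simp only at h
  rcases lt_trichotomy t t' with h' | h' | h'
  · have := key _ _ h'; omega
  · exact h'
  · have := key _ _ h'; omega

-- The r < nd congruent to j are j + n t with t < d, and r belongs to row r / d. That row exceeds j
-- exactly when r ≥ d(j+1).
open Classical in
lemma card_rows_above {d n j : ℕ} (hd : 0 < d) (hdn : d ≤ n) (hj : j < n) :
    ((Finset.range n).filter
      (fun i => j < i ∧ ∃ r, d * i ≤ r ∧ r < d * (i + 1) ∧ r ≡ j [MOD n])).card =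
    ((Finset.range d).filter fun t => d * j + d ≤ j + n * t).card := by
  symm
  rw [← Finset.card_image_of_injOn (add_mul_div_injOn j hd hdn _)]
  symm
  congr 1
  ext i
  simp only [Finset.mem_filter, Finset.mem_range, Finset.mem_image]
  constructor
  · rintro ⟨hi, hji, r, h1, h2, h3⟩
    have h4 : r % n = j := by rw [h3, Nat.mod_eq_of_lt hj]
    have h5 : j + n * (r / n) = r := by rw [← h4, Nat.mod_add_div]
    have h6 : r < n * d := lt_of_lt_of_le h2 (by
      rw [mul_comm n d]; exact Nat.mul_le_mul_left d hi)
    have h7 := Nat.mul_le_mul_left d (Nat.succ_le_of_lt hji)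
    rw [Nat.mul_succ] at h7
    refine ⟨r / n, ⟨Nat.div_lt_of_lt_mul h6, by omega⟩, ?_⟩
    rw [h5]
    exact Nat.div_eq_of_lt_le (by rwa [mul_comm]) (by rwa [mul_comm])
  · rintro ⟨t, ⟨ht, h1⟩, rfl⟩
    have h2 : j + n * t < n * d := by
      have := Nat.mul_le_mul_left n (Nat.succ_le_of_lt ht)
      rw [Nat.mul_succ] at this
      omega
    refine ⟨Nat.div_lt_of_lt_mul (by rwa [mul_comm d n]), ?_, j + n * t, Nat.mul_div_le _ _,
      Nat.lt_mul_div_succ _ hd, by simp [Nat.ModEq]⟩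
    rw [← Nat.succ_le_iff, Nat.le_div_iff_mul_le hd, Nat.succ_mul, mul_comm j d]
    exact h1

-- The same parametrization for column j + 1, whose residue is j on this side of the diagonal. Row r
-- / d is smaller than j + 1 exactly when r < d(j+1).
open Classical in
lemma card_rows_below {d n j : ℕ} (hd : 0 < d) (hdn : d ≤ n) (hj : j < n) :
    ((Finset.range n).filter
      (fun i => i < j + 1 ∧ ∃ r, d * i ≤ r ∧ r < d * (i + 1) ∧ r + 1 ≡ j + 1 [MOD n])).card =
    ((Finset.range d).filter fun t => j + 1 + n * t ≤ d * (j + 1)).card := by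
  symm
  rw [← Finset.card_image_of_injOn (add_mul_div_injOn j hd hdn _)]
  symm
  congr 1
  ext i
  simp only [Finset.mem_filter, Finset.mem_range, Finset.mem_image]
  constructor
  · rintro ⟨hi, hji, r, h1, h2, h3⟩
    have h4 : r % n = j := by
      rw [Nat.ModEq.add_right_cancel' 1 h3, Nat.mod_eq_of_lt hj]
    have h5 : j + n * (r / n) = r := by rw [← h4, Nat.mod_add_div]
    have h6 : r < n * d := lt_of_lt_of_le h2 (by
      rw [mul_comm n d]; exact Nat.mul_le_mul_left d hi)
    have h7 := Nat.mul_le_mul_left d (Nat.succ_le_of_lt hji)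
    rw [Nat.succ_eq_add_one] at h7
    refine ⟨r / n, ⟨Nat.div_lt_of_lt_mul h6, by omega⟩, ?_⟩
    rw [h5]
    exact Nat.div_eq_of_lt_le (by rwa [mul_comm]) (by rwa [mul_comm])
  · rintro ⟨t, ⟨ht, h1⟩, rfl⟩
    have h2 : j + n * t < n * d := by
      have := Nat.mul_le_mul_left n (Nat.succ_le_of_lt ht)
      rw [Nat.mul_succ] at this
      omega
    refine ⟨Nat.div_lt_of_lt_mul (by rwa [mul_comm d n]), ?_, j + n * t, Nat.mul_div_le _ _,
      Nat.lt_mul_div_succ _ hd, by rw [Nat.ModEq, add_right_comm, Nat.add_mul_mod_self_left]⟩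
    rw [Nat.div_lt_iff_lt_mul hd, mul_comm (j + 1) d]
    omega

/-- Among `d` multiples of `n ≥ d` at most one lies strictly between `x` and `x + d`. -/
lemma card_le_add_card_ge {d n : ℕ} (hdn : d ≤ n) (j x : ℕ) :
    d ≤ ((Finset.range d).filter fun t => x + d ≤ j + n * t).card +
        ((Finset.range d).filter fun t => j + n * t ≤ x).card + 1 ∧
      ((Finset.range d).filter fun t => x + d ≤ j + n * t).card +
        ((Finset.range d).filter fun t => j + n * t ≤ x).card ≤ d := by
  classical
  rcases Nat.eq_zero_or_pos d with rfl | hd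
  · simp
  set A := (Finset.range d).filter fun t => x + d ≤ j + n * t
  set B := (Finset.range d).filter fun t => j + n * t ≤ x
  set R := (Finset.range d).filter fun t => ¬ (x + d ≤ j + n * t ∨ j + n * t ≤ x)
  have hAB : A.card + B.card =
      ((Finset.range d).filter fun t => x + d ≤ j + n * t ∨ j + n * t ≤ x).card := by
    rw [Finset.filter_or, Finset.card_union_of_disjoint]
    rw [Finset.disjoint_filter]
    intro t _ h; omega
  have hR : A.card + B.card + R.card = d := by
    rw [hAB]
    exact (Finset.card_filter_add_card_filter_not (s := Finset.range d) _).trans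
      (Finset.card_range d)
  have hR1 : R.card ≤ 1 := by
    rw [Finset.card_le_one]
    intro t ht t' ht'
    simp only [R, Finset.mem_filter] at ht ht'
    by_contra hne
    rcases Nat.lt_or_gt_of_ne hne with h | h
    · have := Nat.mul_le_mul_left n (Nat.succ_le_of_lt h)
      rw [Nat.mul_succ] at this
      omega
    · have := Nat.mul_le_mul_left n (Nat.succ_le_of_lt h)
      rw [Nat.mul_succ] at this
      omega
  omega

-- For 0 < j < n both sides of the diagonal are indexed by the same t, and only a t with dj < j + n
-- t < dj + d is lost, so the diagonal cell brings the count to d or d + 1. The two boundary columns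
-- have cells on one side only and contain exactly d.
open Classical in
lemma card_regularCell_column {d n j : ℕ} (hd : 2 ≤ d) (hdn : d ≤ n) (hj : j ≤ n) :
    d ≤ ((Finset.range n).filter fun i => RegularCell d (n + 1) i j).card ∧
      ((Finset.range n).filter fun i => RegularCell d (n + 1) i j).card ≤ d + 1 := by
  have hsplit : ((Finset.range n).filter fun i => RegularCell d (n + 1) i j).card =
      ((Finset.range n).filter fun i => i = j).card +
      (((Finset.range n).filter fun i => i < j ∧
          ∃ r, d * i ≤ r ∧ r < d * (i + 1) ∧ r + 1 ≡ j [MOD n]).card +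
        ((Finset.range n).filter fun i => j < i ∧
          ∃ r, d * i ≤ r ∧ r < d * (i + 1) ∧ r ≡ j [MOD n]).card) := by
    simp only [RegularCell, Nat.add_sub_cancel]
    rw [Finset.filter_or, Finset.filter_or, Finset.card_union_of_disjoint,
      Finset.card_union_of_disjoint]
    · rw [Finset.disjoint_filter]; intro t _ h; omega
    · rw [← Finset.filter_or, Finset.disjoint_filter]; intro t _ h; omega
  have hd0 : 0 < d := by omega
  have hdiag : ((Finset.range n).filter fun i => i = j).card = if j < n then 1 else 0 := by
    rw [Finset.filter_eq']
    split_ifs <;> simp_all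
  rw [hsplit, hdiag]
  rcases Nat.eq_zero_or_pos j with rfl | hj0
  · rw [card_rows_above hd0 hdn (by omega), if_pos (by omega)]
    have h1 : ((Finset.range n).filter fun i => i < 0 ∧
          ∃ r, d * i ≤ r ∧ r < d * (i + 1) ∧ r + 1 ≡ 0 [MOD n]) = ∅ := by
      simp
    -- For column 0 the lost index is t = 0, since n t ≥ d as soon as t ≥ 1.
    have h2 : ((Finset.range d).filter fun t => d * 0 + d ≤ 0 + n * t) =
        (Finset.range d).erase 0 := by
      ext t
      simp only [Finset.mem_filter, Finset.mem_range, Finset.mem_erase]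
      constructor
      · rintro ⟨h, h'⟩
        refine ⟨?_, h⟩
        rintro rfl
        simp at h'; omega
      · rintro ⟨h, h'⟩
        have := Nat.mul_le_mul_left n (Nat.one_le_iff_ne_zero.2 h)
        omega
    rw [h1, h2, Finset.card_erase_of_mem (by simpa using hd0)]
    simp; omega
  · obtain ⟨k, rfl⟩ : ∃ k, j = k + 1 := ⟨j - 1, by omega⟩
    rw [card_rows_below hd0 hdn (by omega)]
    rcases Nat.lt_or_ge (k + 1) n with h | h
    · rw [card_rows_above hd0 hdn h, if_pos h]
      have := card_le_add_card_ge hdn (k + 1) (d * (k + 1))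
      omega
    · obtain rfl : n = k + 1 := by omega
      have h1 : ((Finset.range (k + 1)).filter fun i => k + 1 < i ∧
          ∃ r, d * i ≤ r ∧ r < d * (i + 1) ∧ r ≡ k + 1 [MOD (k + 1)]) = ∅ := by
        ext i
        simp only [Finset.mem_filter, Finset.mem_range]
        constructor
        · rintro ⟨h, h', _⟩; omega
        · intro h; simp at h
      have h2 : ((Finset.range d).filter fun t => k + 1 + (k + 1) * t ≤ d * (k + 1)) =
          Finset.range d := by
        apply Finset.filter_true_of_mem
        intro t ht
        rw [Finset.mem_range] at ht
        have := Nat.mul_le_mul_left (k + 1) (Nat.succ_le_of_lt ht)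
        rw [Nat.mul_succ, mul_comm (k + 1) d] at this
        omega
      rw [h1, h2, if_neg (by omega)]
      simp

open Classical in
lemma sum_regularCell_eq_card (d n j : ℕ) :
    ∑ i' : Fin (n + 1), (if (i' : ℕ) + 1 < n + 1 ∧ RegularCell d (n + 1) i' j then 1 else 0) =
      ((Finset.range n).filter fun i => RegularCell d (n + 1) i j).card := by
  rw [Fin.sum_univ_castSucc, Finset.card_filter, Finset.sum_range]
  simp

lemma sum_worstDesign_column {d I : ℕ} (hd : 2 ≤ d) (hI : d + 1 ≤ I) (j : Fin I) :
    ∑ i, worstDesign d I i j = d + 1 := by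
  classical
  obtain ⟨n, rfl⟩ : ∃ n, I = n + 1 := ⟨I - 1, by omega⟩
  have hcol := card_regularCell_column hd (by omega : d ≤ n) (by omega : (j : ℕ) ≤ n)
  have hsum : ∑ i : Fin n, worstDesign d (n + 1) i.castSucc j =
      ((Finset.range n).filter fun i => RegularCell d (n + 1) i j).card := by
    rw [Finset.card_filter, Finset.sum_range]
    exact Finset.sum_congr rfl fun i _ => by simp [worstDesign]
  rw [Fin.sum_univ_castSucc, hsum, worstDesign, if_neg (by simp), sum_regularCell_eq_card]
  split_ifs <;> omega

lemma sum_worstDesign_row_lt {d I : ℕ} (hI : d + 1 ≤ I) (i : Fin I)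
    (hi : (i : ℕ) + 1 < I) : ∑ j, worstDesign d I i j = d + 1 := by
  classical
  obtain ⟨n, rfl⟩ : ∃ n, I = n + 1 := ⟨I - 1, by omega⟩
  rw [← card_regularCell_row (by omega : d ≤ n) (by omega : (i : ℕ) < n), Finset.card_filter,
    Finset.sum_range]
  exact Finset.sum_congr rfl fun j _ => by simp only [worstDesign, if_pos hi]

lemma sum_worstDesign_row {d I : ℕ} (hd : 2 ≤ d) (hI : d + 1 ≤ I) (i : Fin I) :
    ∑ j, worstDesign d I i j = d + 1 := by
  by_cases hi : (i : ℕ) + 1 < I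
  · exact sum_worstDesign_row_lt hI i hi
  obtain ⟨n, rfl⟩ : ∃ n, I = n + 1 := ⟨I - 1, by omega⟩
  obtain rfl : i = Fin.last n := Fin.ext (by simp; omega)
  -- The last row is found by double counting: all columns and all other rows are already known to
  -- sum to d + 1.
  have htot : ∑ i, ∑ j, worstDesign d (n + 1) i j = (n + 1) * (d + 1) := by
    rw [Finset.sum_comm, Finset.sum_congr rfl fun j _ => sum_worstDesign_column hd hI j]
    simp
  rw [Fin.sum_univ_castSucc, Finset.sum_congr rfl fun (i : Fin n) _ =>
    sum_worstDesign_row_lt hI i.castSucc (by simp)] at htot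
  simp only [Finset.sum_const, Finset.card_univ, Fintype.card_fin, smul_eq_mul, add_mul n,
    one_mul] at htot
  omega

lemma worstDesign_le_one (d I : ℕ) (i j : Fin I) : worstDesign d I i j ≤ 1 := by
  unfold worstDesign
  split_ifs <;> simp

/-- Row `(j - 1) / d` links column `j` to column `(j - 1) / d`. -/
lemma worstDesign_tree {d I j : ℕ} (hd : 2 ≤ d) (hj0 : 0 < j) (hj : j < I) :
    ∃ h : (j - 1) / d < I, worstDesign d I ⟨(j - 1) / d, h⟩ ⟨(j - 1) / d, h⟩ = 1 ∧
      worstDesign d I ⟨(j - 1) / d, h⟩ ⟨j, hj⟩ = 1 := by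
  have h1 : (j - 1) / d ≤ j - 1 := Nat.div_le_self _ _
  refine ⟨by omega, ?_, ?_⟩
  · rw [worstDesign, if_pos (by simp; omega), if_pos (show RegularCell _ _ _ _ from Or.inl rfl)]
  · rw [worstDesign, if_pos (by simp; omega), if_pos]
    -- The witness r = j - 1 lies in its own block of length d, whose index is the row (j-1)/d.
    refine Or.inr (Or.inl ⟨by simp; omega, j - 1, Nat.mul_div_le _ _,
      Nat.lt_mul_div_succ _ (by omega), ?_⟩)
    rw [Nat.sub_add_cancel hj0]

namespace Model

variable {I N : ℕ}

lemma occ_zero_eq_sum (D : Model I N) (i : Fin I) : D.occ 0 i = ∑ j, D.cooc i j := by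
  classical
  simp only [occ, cooc]
  rw [Finset.card_eq_sum_card_fiberwise (f := D.lev 1) (t := Finset.univ) (by simp)]
  simp [Finset.filter_filter]

lemma occ_one_eq_sum (D : Model I N) (j : Fin I) : D.occ 1 j = ∑ i, D.cooc i j := by
  classical
  simp only [occ, cooc]
  rw [Finset.card_eq_sum_card_fiberwise (f := D.lev 0) (t := Finset.univ) (by simp)]
  simp [Finset.filter_filter, and_comm]

lemma sum_occ (D : Model I N) (k : Fin 2) : ∑ i, D.occ k i = N := by
  classical
  have := Finset.card_eq_sum_card_fiberwise (s := (Finset.univ : Finset (Fin N)))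
    (f := D.lev k) (t := Finset.univ) (by simp)
  simpa [occ] using this.symm

lemma occ_of_worstDesign (D : Model I N) {d : ℕ} (hd : 2 ≤ d) (hI : d + 1 ≤ I)
    (h : ∀ i j, D.cooc i j = worstDesign d I i j) (k : Fin 2) (i : Fin I) :
    D.occ k i = d + 1 := by
  fin_cases k
  · simp only [Fin.zero_eta, occ_zero_eq_sum, h, sum_worstDesign_row hd hI]
  · simp only [Fin.mk_one, occ_one_eq_sum, h, sum_worstDesign_column hd hI]

lemma card_obs_of_occ (D : Model I N) {c : ℕ} (h : ∀ k i, D.occ k i = c) : N = I * c := by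
  rw [← D.sum_occ 0]
  simp [h]

lemma nbar_of_occ (D : Model I N) {c : ℕ} (hI : 0 < I) (h : ∀ k i, D.occ k i = c) :
    D.nbar = c := by
  have hI' : (I : ℝ) ≠ 0 := by positivity
  rw [nbar, p, D.card_obs_of_occ h]
  push_cast
  field_simp

lemma balancedLevels_of_occ (D : Model I N) {c : ℕ} (hI : 0 < I) (h : ∀ k i, D.occ k i = c) :
    D.BalancedLevels := by
  intro k i
  have hI' : (I : ℝ) ≠ 0 := by positivity
  rw [h, D.card_obs_of_occ h]
  push_cast
  field_simp

/-! ### Sparsity of the posterior precision matrix -/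

lemma designMatrix_nonneg (D : Model I N) (n : Fin N) (v : Option (Fin 2 × Fin I)) :
    0 ≤ D.designMatrix n v := by
  rcases v with _ | ⟨k, i⟩
  · simp [designMatrix]
  · simp only [designMatrix]; split_ifs <;> norm_num

/-- Off the diagonal, Q is τ times a sum of products of nonnegative entries, so nothing cancels: an
entry is non-zero as soon as one observation involves both parameters. -/
lemma precision_ne_zero_iff (D : Model I N) (hτ : 0 < D.τ) {a b : Fin (2 * I + 1)}
    (hab : a ≠ b) : D.precision a b ≠ 0 ↔
      ∃ n, D.designMatrix n (ordering I a) ≠ 0 ∧ D.designMatrix n (ordering I b) ≠ 0 := by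
  have hne : ordering I a ≠ ordering I b := fun h => hab ((ordering I).injective h)
  simp only [precision, Matrix.submatrix_apply, Matrix.add_apply, Matrix.diagonal_apply_ne _ hne,
    zero_add, Matrix.smul_apply, Matrix.mul_apply, Matrix.transpose_apply, smul_eq_mul]
  rw [mul_ne_zero_iff, and_iff_right hτ.ne', Ne, Finset.sum_eq_zero_iff_of_nonneg
    (fun n _ => mul_nonneg (D.designMatrix_nonneg _ _) (D.designMatrix_nonneg _ _))]
  simp [not_or]

lemma condIndepGraph_precision_adj (D : Model I N) (hτ : 0 < D.τ) {a b : Fin (2 * I + 1)} :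
    (condIndepGraph D.precision).Adj a b ↔ a ≠ b ∧
      ∃ n, D.designMatrix n (ordering I a) ≠ 0 ∧ D.designMatrix n (ordering I b) ≠ 0 := by
  rw [condIndepGraph, SimpleGraph.fromRel_adj]
  refine and_congr_right fun hab => ?_
  rw [D.precision_ne_zero_iff hτ hab, D.precision_ne_zero_iff hτ hab.symm]
  simp [and_comm]

/-- Position of level `i` of factor `k` in the ordering. -/
def pos (k : Fin 2) (i : Fin I) : Fin (2 * I + 1) := (ordering I).symm (some (k, i))

lemma val_pos (k : Fin 2) (i : Fin I) : (pos k i : ℕ) = i + I * k := by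
  have : pos k i = (finProdFinEquiv (k, i)).castSucc := by
    rw [pos, Equiv.symm_apply_eq]
    simp [ordering, Equiv.eq_symm_apply]
  rw [this]
  simp [finProdFinEquiv]

@[simp] lemma ordering_pos (k : Fin 2) (i : Fin I) : ordering I (pos k i) = some (k, i) := by
  simp [pos]

@[simp] lemma ordering_last : ordering I (Fin.last (2 * I)) = none := by
  simp [ordering]

lemma adj_of_cooc (D : Model I N) (hτ : 0 < D.τ) {i j : Fin I} (h : D.cooc i j = 1) :
    (condIndepGraph D.precision).Adj (pos 0 i) (pos 1 j) := by
  rw [D.condIndepGraph_precision_adj hτ]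
  refine ⟨fun h => ?_, ?_⟩
  · have := congrArg (ordering I) h
    simp at this
  · obtain ⟨n, hn⟩ : ∃ n, n ∈ Finset.univ.filter fun n => D.lev 0 n = i ∧ D.lev 1 n = j := by
      apply Finset.Nonempty.exists_mem
      rw [← Finset.card_pos]
      exact h.symm.subst (motive := fun c => 0 < c) one_pos
    refine ⟨n, ?_⟩
    simp_all [designMatrix]

lemma adj_last (D : Model I N) (hτ : 0 < D.τ) {k : Fin 2} {i : Fin I} (h : 0 < D.occ k i) :
    (condIndepGraph D.precision).Adj (pos k i) (Fin.last _) := by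
  rw [D.condIndepGraph_precision_adj hτ]
  refine ⟨fun h => ?_, ?_⟩
  · have := congrArg (ordering I) h
    simp at this
  · obtain ⟨n, hn⟩ := (Finset.card_pos.1 h).exists_mem
    refine ⟨n, ?_⟩
    simp_all [designMatrix]

/-- No cell is observed twice, so distinct observations give distinct entries (second-factor level,
first-factor level), all in the lower triangle. -/
lemma card_obs_le_nQ (D : Model I N) (hτ : 0 < D.τ) (h : ∀ i j, D.cooc i j ≤ 1) :
    N ≤ nQ D.precision := by
  classical
  have : (Finset.univ.image fun n : Fin N =>
      ((pos 1 (D.lev 1 n), pos 0 (D.lev 0 n)) : Fin (2 * I + 1) × Fin (2 * I + 1))).card = N := by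
    rw [Finset.card_image_of_injective, Finset.card_univ, Fintype.card_fin]
    intro n n' hnn
    simp only [Prod.mk.injEq, pos, EmbeddingLike.apply_eq_iff_eq, Option.some.injEq, true_and]
      at hnn
    have h1 := h (D.lev 0 n) (D.lev 1 n)
    rw [cooc, Finset.card_le_one] at h1
    exact h1 n (by simp) n' (by simp [hnn])
  conv_lhs => rw [← this]
  apply Finset.card_le_card
  intro x hx
  simp only [Finset.mem_image, Finset.mem_univ, true_and] at hx
  obtain ⟨n, rfl⟩ := hx
  simp only [Finset.mem_filter, Finset.mem_univ, true_and]
  refine ⟨?_, (D.precision_ne_zero_iff hτ fun h => ?_).2 ⟨n, ?_⟩⟩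
  · rw [Fin.le_def, val_pos, val_pos]
    have := (D.lev 0 n).2
    simp; omega
  · have := congrArg (ordering I) h
    simp at this
  · simp [designMatrix]

/-- Each observation involves three parameters and creates at most a 3 × 3 block of non-zeros; the
rest is diagonal. -/
lemma nQ_le (D : Model I N) (hτ : 0 < D.τ) : nQ D.precision ≤ 2 * I + 1 + 9 * N := by
  classical
  let V : Fin N → Finset (Fin (2 * I + 1)) := fun n =>
    {Fin.last _, pos 0 (D.lev 0 n), pos 1 (D.lev 1 n)}
  have hV : ∀ n, (V n).card ≤ 3 := fun n => Finset.card_le_three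
  have hVm : ∀ n a, D.designMatrix n (ordering I a) ≠ 0 → a ∈ V n := by
    intro n a h
    obtain ⟨v, rfl⟩ := (ordering I).symm.surjective a
    rcases v with _ | ⟨k, i⟩
    · have : (ordering I).symm none = Fin.last _ := by rw [Equiv.symm_apply_eq, ordering_last]
      simp [V, this]
    · simp only [Equiv.apply_symm_apply, designMatrix, ne_eq, ite_eq_right_iff, one_ne_zero,
        imp_false, not_not] at h
      fin_cases k <;> simp_all [V, pos]
  have hsub : (Finset.univ.filter fun x : Fin (2 * I + 1) × Fin (2 * I + 1) =>
      x.2 ≤ x.1 ∧ D.precision x.1 x.2 ≠ 0) ⊆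
      (Finset.univ.image fun a => (a, a)) ∪ Finset.univ.biUnion fun n => V n ×ˢ V n := by
    rintro ⟨a, b⟩ hx
    simp only [Finset.mem_filter, Finset.mem_univ, true_and] at hx
    by_cases hab : a = b
    · exact Finset.mem_union_left _ (by simp [hab])
    · obtain ⟨n, h1, h2⟩ := (D.precision_ne_zero_iff hτ hab).1 hx.2
      apply Finset.mem_union_right
      simp only [Finset.mem_biUnion, Finset.mem_univ, true_and, Finset.mem_product]
      exact ⟨n, hVm n a h1, hVm n b h2⟩
  refine (Finset.card_le_card hsub).trans ((Finset.card_union_le _ _).trans ?_)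
  gcongr
  · exact Finset.card_image_le.trans (by simp)
  · refine Finset.card_biUnion_le.trans ((Finset.sum_le_card_nsmul _ _ 9 fun n _ => ?_).trans ?_)
    · rw [Finset.card_product]
      exact Nat.mul_le_mul (hV n) (hV n)
    · simp [mul_comm]

/-! ### Fill-in of the Cholesky factor -/

/-- Two edges, through row (j-1)/d, lead from column j to its parent column. Row vertices never
exceed the bound, since all first-factor levels come before all second-factor levels. -/
lemma exists_walk_to_root (D : Model I N) {d : ℕ} (hτ : 0 < D.τ) (hd : 2 ≤ d)
    (h : ∀ i j, D.cooc i j = worstDesign d I i j) (hI : 0 < I) (j : ℕ) (hj : j < I) :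
    ∃ w : (condIndepGraph D.precision).Walk (pos 1 ⟨j, hj⟩) (pos 1 ⟨0, hI⟩),
      ∀ v ∈ w.support, v ≤ pos 1 ⟨j, hj⟩ := by
  induction j using Nat.strong_induction_on with
  | _ j ih =>
    rcases Nat.eq_zero_or_pos j with rfl | hj0
    · exact ⟨.nil, by simp⟩
    · obtain ⟨hi, h1, h2⟩ := worstDesign_tree hd hj0 hj
      have hlt : (j - 1) / d < j := lt_of_le_of_lt (Nat.div_le_self _ _) (by omega)
      obtain ⟨w, hw⟩ := ih _ hlt hi
      refine ⟨.cons (D.adj_of_cooc hτ ((h _ _).trans h2)).symm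
        (.cons (D.adj_of_cooc hτ ((h _ _).trans h1)) w), ?_⟩
      intro v hv
      simp only [SimpleGraph.Walk.support_cons, List.mem_cons] at hv
      rcases hv with rfl | rfl | hv
      · exact le_rfl
      · rw [Fin.le_def, val_pos, val_pos]; simp; omega
      · refine (hw v hv).trans ?_
        rw [Fin.le_def, val_pos, val_pos]; simp; omega

/-- The path climbs from the level of l to the root, descends to the parent of the level of t, and
takes the last two edges to t. If t is a⁽⁰⁾, it is already a neighbour of l. -/
lemma potentialNonzero_of_le (D : Model I N) {d : ℕ} (hτ : 0 < D.τ) (hd : 2 ≤ d)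
    (h : ∀ i j, D.cooc i j = worstDesign d I i j) (hocc : ∀ k i, 0 < D.occ k i)
    {l t : Fin (2 * I + 1)} (hl : I + I / 2 ≤ (l : ℕ)) (hlt : l ≤ t) :
    PotentialNonzero (condIndepGraph D.precision) t l := by
  refine ⟨hlt, fun hsep => ?_⟩
  suffices ∃ w : (condIndepGraph D.precision).Walk l t, ∀ v ∈ w.support, v ≤ l ∨ v = t by
    obtain ⟨w, hw⟩ := this
    obtain ⟨v, hv, hv1, hv2⟩ := hsep w
    rcases hw v hv with h' | h'
    · exact absurd hv1 (not_lt.2 h')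
    · exact hv2 h'
  rcases hlt.eq_or_lt with rfl | hlt
  · exact ⟨.nil, by simp⟩
  have hlI : (l : ℕ) < 2 * I := by have := t.2; rw [Fin.lt_def] at hlt; omega
  have hI : 0 < I := by omega
  have hm : (l : ℕ) - I < I := by omega
  obtain ⟨m, rfl⟩ : ∃ m : Fin I, l = pos 1 m :=
    ⟨⟨l - I, hm⟩, Fin.ext (by rw [val_pos]; simp; omega)⟩
  rw [val_pos] at hl
  rcases eq_or_ne t (Fin.last _) with rfl | ht
  · exact ⟨.cons (D.adj_last hτ (hocc 1 m)) .nil, by simp⟩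
  have ht' := Fin.val_lt_last ht
  rw [Fin.lt_def, val_pos] at hlt
  simp only [Fin.val_one, mul_one] at hl hlt
  obtain ⟨j, hj, rfl⟩ : ∃ (j : ℕ) (hj : j < I), t = pos 1 ⟨j, hj⟩ :=
    ⟨t - I, by omega, Fin.ext (by rw [val_pos]; simp; omega)⟩
  simp only [val_pos, Fin.val_one, mul_one] at hlt
  obtain ⟨hi, h1, h2⟩ := worstDesign_tree hd (by omega : 0 < j) hj
  -- This is where the threshold I + I/2 is used: the parent of any level j < I is at most (j-1)/2 ≤
  -- I/2 ≤ m.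
  have hpm : (j - 1) / d ≤ m := by
    have e1 : (j - 1) / d ≤ (j - 1) / 2 := Nat.div_le_div_left hd (by norm_num)
    omega
  obtain ⟨w₁, hw₁⟩ := D.exists_walk_to_root hτ hd h hI m m.2
  obtain ⟨w₂, hw₂⟩ := D.exists_walk_to_root hτ hd h hI _ hi
  refine ⟨w₁.append (w₂.reverse.append (.cons (D.adj_of_cooc hτ ((h _ _).trans h1)).symm
    (.cons (D.adj_of_cooc hτ ((h _ _).trans h2)) .nil))), ?_⟩
  intro v hv
  simp only [SimpleGraph.Walk.mem_support_append_iff, SimpleGraph.Walk.support_reverse,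
    List.mem_reverse, SimpleGraph.Walk.support_cons, SimpleGraph.Walk.support_nil,
    List.mem_cons, List.not_mem_nil, or_false] at hv
  rcases hv with hv | hv | rfl | rfl | rfl
  · exact Or.inl (hw₁ v hv)
  · refine Or.inl ((hw₂ v hv).trans ?_)
    rw [Fin.le_def, val_pos, val_pos]; simpa using hpm
  · left; rw [Fin.le_def, val_pos, val_pos]; simpa using hpm
  · left; rw [Fin.le_def, val_pos, val_pos]; simp; omega
  · exact Or.inr rfl

end Model

/-! ### Flops of the sparse Cholesky factorization -/

open Classical in
lemma ops_choleskyEntry {M : ℕ} (Q L : Matrix (Fin M) (Fin M) ℝ) (j m : Fin M) :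
    (choleskyEntry Q L j m).ops = 2 * (Finset.univ.filter fun l => l < m ∧
      PotentialNonzero (condIndepGraph Q) m l ∧ PotentialNonzero (condIndepGraph Q) j l).card
      + 1 := by
  simp only [choleskyEntry, Counted.ops_bind]
  rw [Counted.ops_foldlM _ (fun _ => 2) (by intros; simp)]
  have h2 : ∀ s : ℝ, (if j = m then op (Real.sqrt s) else op (s / L m m)).ops = 1 := by
    intro s; split_ifs <;> rfl
  rw [h2, List.map_const', List.sum_replicate, smul_eq_mul, mul_comm]
  congr 2

open Classical in
lemma costSLA_eq_sum {M : ℕ} (Q : Matrix (Fin M) (Fin M) ℝ) :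
    costSLA Q = ∑ m, ∑ j, if PotentialNonzero (condIndepGraph Q) j m then
      2 * (Finset.univ.filter fun l => l < m ∧
        PotentialNonzero (condIndepGraph Q) m l ∧ PotentialNonzero (condIndepGraph Q) j l).card
        + 1 else 0 := by
  rw [costSLA, cholesky, Counted.ops_foldlM _ (fun m => ∑ j, if PotentialNonzero
    (condIndepGraph Q) j m then 2 * (Finset.univ.filter fun l => l < m ∧
        PotentialNonzero (condIndepGraph Q) m l ∧ PotentialNonzero (condIndepGraph Q) j l).card
        + 1 else 0), Fin.sum_univ_def]
  intro L m
  rw [choleskyColumn, Counted.ops_foldlM _ (fun j => 2 * (Finset.univ.filter fun l => l < m ∧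
        PotentialNonzero (condIndepGraph Q) m l ∧ PotentialNonzero (condIndepGraph Q) j l).card
        + 1), ← Finset.sum_filter]
  · rw [Finset.sum]
    simp [Finset.filter, Fin.univ_def]
  · intro A j
    simp [ops_choleskyEntry]

lemma nL_le {M : ℕ} (Q : Matrix (Fin M) (Fin M) ℝ) : nL Q ≤ M * M := by
  refine (Finset.sum_le_card_nsmul _ _ M fun m _ => ?_).trans (by simp)
  exact (Finset.card_le_univ _).trans (by simp)

lemma costSLA_le {M : ℕ} (Q : Matrix (Fin M) (Fin M) ℝ) :
    costSLA Q ≤ M * (M * (2 * M + 1)) := by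
  classical
  rw [costSLA_eq_sum]
  refine (Finset.sum_le_card_nsmul _ _ (M * (2 * M + 1)) fun m _ => ?_).trans (by simp)
  refine (Finset.sum_le_card_nsmul _ _ (2 * M + 1) fun j _ => ?_).trans (by simp)
  split_ifs
  · gcongr
    exact (Finset.card_le_univ _).trans (by simp)
  · exact Nat.zero_le _

/-- The Cholesky factor is dense from row and column `s₀` on. -/
def DenseFrom {M : ℕ} (Q : Matrix (Fin M) (Fin M) ℝ) (s₀ : ℕ) : Prop :=
  ∀ l t : Fin M, s₀ ≤ (l : ℕ) → l ≤ t → PotentialNonzero (condIndepGraph Q) t l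

lemma sum_range_le_sum_fin {s₀ s : ℕ} (f : Fin (s₀ + s) → ℕ) (g : ℕ → ℕ)
    (h : ∀ m : Fin (s₀ + s), s₀ ≤ (m : ℕ) → g (m - s₀) ≤ f m) :
    ∑ x ∈ Finset.range s, g x ≤ ∑ m, f m := by
  rw [Fin.sum_univ_add, Finset.sum_range]
  refine le_add_left (Finset.sum_le_sum fun x _ => ?_)
  simpa using h (Fin.natAdd s₀ x) (by simp)

lemma card_filter_ge {s₀ s : ℕ} (m : Fin (s₀ + s)) (P : Fin (s₀ + s) → Prop) [DecidablePred P]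
    (h : ∀ j, m ≤ j → P j) : s - (m - s₀) ≤ (Finset.univ.filter P).card := by
  have h1 : (Finset.Ici m).card ≤ (Finset.univ.filter P).card :=
    Finset.card_le_card fun j hj => by simpa using h j (by simpa using hj)
  rw [Fin.card_Ici] at h1
  omega

/-- Inductive step for the weighted sums below: enlarging s by one adds the full partial sum of g.
-/
lemma sum_range_sub_mul_succ (s : ℕ) (g : ℕ → ℕ) :
    ∑ x ∈ Finset.range (s + 1), (s + 1 - x) * g x =
      ∑ x ∈ Finset.range s, (s - x) * g x + ∑ x ∈ Finset.range (s + 1), g x := by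
  have h : ∀ x ∈ Finset.range (s + 1), (s + 1 - x) * g x = (s - x) * g x + g x := by
    intro x hx
    rw [Finset.mem_range] at hx
    rw [show s + 1 - x = (s - x) + 1 by omega, add_mul, one_mul]
  rw [Finset.sum_congr rfl h, Finset.sum_add_distrib, Finset.sum_range_succ (n := s)
    (f := fun x => (s - x) * g x)]
  simp

lemma DenseFrom.le_nL {M s₀ s : ℕ} {Q : Matrix (Fin M) (Fin M) ℝ}
    (hQ : DenseFrom Q s₀) (hM : M = s₀ + s) : s ^ 2 ≤ 2 * nL Q := by
  subst hM
  classical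
  have h : ∑ x ∈ Finset.range s, (s - x) ≤ nL Q :=
    sum_range_le_sum_fin _ (fun x => s - x) fun m hm => card_filter_ge m _ fun j hj => hQ m j hm hj
  have h2 : s ^ 2 ≤ 2 * ∑ x ∈ Finset.range s, (s - x) := by
    clear h hQ Q
    induction s with
    | zero => simp
    | succ s ih =>
      have := sum_range_sub_mul_succ s (fun _ => 1)
      simp only [mul_one, Finset.sum_const, Finset.card_range, smul_eq_mul] at this
      rw [this]
      nlinarith
  omega

/-- Column s₀ + x has at least s - x entries, each with at least x products (two flops each) and one
final operation. The sum of (s - x)(2x + 1) equals 1² + … + s², which is at least s³/3. -/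
lemma DenseFrom.le_costSLA {M s₀ s : ℕ} {Q : Matrix (Fin M) (Fin M) ℝ}
    (hQ : DenseFrom Q s₀) (hM : M = s₀ + s) : s ^ 3 ≤ 3 * costSLA Q := by
  subst hM
  classical
  have h : ∑ x ∈ Finset.range s, (s - x) * (2 * x + 1) ≤ costSLA Q := by
    rw [costSLA_eq_sum]
    refine sum_range_le_sum_fin _ (fun x => (s - x) * (2 * x + 1)) fun m hm => ?_
    rw [← Finset.sum_filter]
    refine le_trans ?_ (Finset.card_nsmul_le_sum _ _ (2 * (m - s₀) + 1) fun j hj => ?_)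
    · rw [smul_eq_mul]
      gcongr
      exact card_filter_ge m _ fun j hj => hQ m j hm hj
    · gcongr
      have hmj : m ≤ j := by
        simp only [Finset.mem_filter, Finset.mem_univ, true_and] at hj
        exact hj.1
      have h1 : (Finset.Ico (⟨s₀, by omega⟩ : Fin (s₀ + s)) m).card = m - s₀ := by
        rw [Fin.card_Ico]
      rw [← h1]
      refine Finset.card_le_card fun l hl => ?_
      rw [Finset.mem_Ico, Fin.le_def] at hl
      simp only [Finset.mem_filter, Finset.mem_univ, true_and]
      exact ⟨hl.2, hQ l m hl.1 hl.2.le, hQ l j hl.1 (hl.2.le.trans hmj)⟩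
  have h2 : s ^ 3 ≤ 3 * ∑ x ∈ Finset.range s, (s - x) * (2 * x + 1) := by
    clear h hQ Q
    induction s with
    | zero => simp
    | succ s ih =>
      have h1 : ∀ r : ℕ, ∑ x ∈ Finset.range r, (2 * x + 1) = r ^ 2 := by
        intro r
        induction r with
        | zero => simp
        | succ r ih => rw [Finset.sum_range_succ, ih]; ring
      rw [sum_range_sub_mul_succ, h1]
      have h3 : (s + 1) ^ 3 = s ^ 3 + 3 * s ^ 2 + 3 * s + 1 := by ring
      have h4 : (s + 1) ^ 2 = s ^ 2 + 2 * s + 1 := by ring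
      omega
  omega

namespace Model

variable {I N : ℕ}

/-- The dense trailing block has order s ≥ I/2 = p/4. The binding constants come from the flops:
from below s³/3 ≥ p³/192, and from above 3I · 3I · 5I = 45p³/8, using M ≤ 3I and 2M + 1 ≤ 5I. -/
lemma precision_sparsity (D : Model I N) {d : ℕ} (hτ : 0 < D.τ) (hd : 2 ≤ d) (hI : d + 1 ≤ I)
    (h : ∀ i j, D.cooc i j = worstDesign d I i j) :
    (1 / 200 * (D.p * D.nbar) ≤ nQ D.precision ∧ nQ D.precision ≤ 6 * (D.p * D.nbar)) ∧
    (1 / 200 * D.p ^ 2 ≤ nL D.precision ∧ nL D.precision ≤ 6 * D.p ^ 2) ∧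
    (1 / 200 * D.p ^ 3 ≤ costSLA D.precision ∧ costSLA D.precision ≤ 6 * D.p ^ 3) := by
  have hocc := D.occ_of_worstDesign hd hI h
  have hN := D.card_obs_of_occ hocc
  have hI3 : (3 : ℝ) ≤ I := by exact_mod_cast (by omega : 3 ≤ I)
  have hpn : D.p * D.nbar = 2 * N := by
    rw [D.nbar_of_occ (by omega) hocc, p, hN]; push_cast; ring
  have hdense : DenseFrom D.precision (I + I / 2) := fun l t hl hlt =>
    D.potentialNonzero_of_le hτ hd h (fun k i => by rw [hocc]; omega) hl hlt
  obtain ⟨s, hs⟩ : ∃ s, 2 * I + 1 = (I + I / 2) + s := ⟨2 * I + 1 - (I + I / 2), by omega⟩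
  have hsI : (I : ℝ) ≤ 2 * s := by exact_mod_cast (by omega : I ≤ 2 * s)
  have hL1 := hdense.le_nL hs
  have hS1 := hdense.le_costSLA hs
  have hL2 := nL_le D.precision
  have hS2 := costSLA_le D.precision
  have hQ1 := D.card_obs_le_nQ hτ fun i j => (h i j).trans_le (worstDesign_le_one d I i j)
  have hQ2 := D.nQ_le hτ
  have hNI : 3 * I ≤ N := by rw [hN]; nlinarith
  rw [hpn, p]
  generalize nQ D.precision = q at *
  generalize nL D.precision = l at *
  generalize costSLA D.precision = c at *
  rify at hL1 hS1 hL2 hS2 hQ1 hQ2 hNI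
  have hs2 : (I : ℝ) ^ 2 ≤ (2 * s) ^ 2 := by gcongr
  have hs3 : (I : ℝ) ^ 3 ≤ (2 * s) ^ 3 := by gcongr
  have hM : (2 * I + 1 : ℝ) ≤ 3 * I := by linarith
  have hM2 : (2 * I + 1 : ℝ) * (2 * I + 1) ≤ 3 * I * (3 * I) := by gcongr
  have hM3 : (2 * I + 1 : ℝ) * ((2 * I + 1) * (2 * (2 * I + 1) + 1)) ≤
      3 * I * (3 * I * (5 * I)) := by
    gcongr; linarith
  have hI2 : (0 : ℝ) ≤ I ^ 2 := by positivity
  have hI3' : (0 : ℝ) ≤ I ^ 3 := by positivity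
  refine ⟨⟨by linarith, by linarith⟩, ⟨by nlinarith, by nlinarith⟩, ⟨by nlinarith, by nlinarith⟩⟩

/-! ### Values and costs of the block programs -/

/-- Sum of the residuals at level `i` of factor `k`, given the effects `b` of the other factor. -/
noncomputable def resSum (D : Model I N) (k : Fin 2) (b : Fin I → ℝ) (i : Fin I) : ℝ :=
  ∑ n, if D.lev k n = i then D.y n - b (D.lev k.rev n) else 0

/-- Conditional precision of the effect of level `i` of factor `k`. -/
noncomputable def levelPrec (D : Model I N) (k : Fin 2) (i : Fin I) : ℝ :=
  D.τf k + D.τ * D.occ k i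

/-- Precision of an observation mean at level `i` of factor `k` with the level effect integrated
out, per observation. -/
noncomputable def levelWeight (D : Model I N) (k : Fin 2) (i : Fin I) : ℝ :=
  D.τ * D.τf k / D.levelPrec k i

/-- Precision of `a⁽⁰⁾` given the effects of the factor `k.rev`. -/
noncomputable def globalPrec (D : Model I N) (k : Fin 2) : ℝ :=
  D.tpr + ∑ i, D.levelWeight k i * D.occ k i

/-- Mean of `a⁽⁰⁾` given the effects `b` of the factor `k.rev`. -/
noncomputable def globalMean (D : Model I N) (k : Fin 2) (b : Fin I → ℝ) : ℝ :=
  (D.tpr * D.μpr + ∑ i, D.levelWeight k i * D.resSum k b i) / D.globalPrec k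

/-- Mean of the effect of level `i` of factor `k` given `a⁽⁰⁾` and the effects of the other
factor. -/
noncomputable def levelMean (D : Model I N) (k : Fin 2) (b : Fin I → ℝ) (a₀ : ℝ) (i : Fin I) : ℝ :=
  D.τ * (D.resSum k b i - D.occ k i * a₀) / D.levelPrec k i

/-- The block drawn by the program of factor `k` from the noise `z`. -/
noncomputable def blockDraw (D : Model I N) (k : Fin 2) (b : Fin I → ℝ) (z : Noise I) :
    ℝ × (Fin I → ℝ) :=
  (D.globalMean k b + z.1 / √(D.globalPrec k), fun i =>
    D.levelMean k b (D.globalMean k b + z.1 / √(D.globalPrec k)) i + z.2 i / √(D.levelPrec k i))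

lemma foldl_update_add {ι β : Type} [DecidableEq ι] (f g : β → ℝ) (κ : β → ι) (l : List β)
    (c s : ι → ℝ) :
    l.foldl (fun (cs : (ι → ℝ) × (ι → ℝ)) n =>
      (Function.update cs.1 (κ n) (cs.1 (κ n) + f n),
        Function.update cs.2 (κ n) (cs.2 (κ n) + g n))) (c, s) =
      (fun i => c i + (l.map fun n => if κ n = i then f n else 0).sum,
        fun i => s i + (l.map fun n => if κ n = i then g n else 0).sum) := by
  induction l generalizing c s with
  | nil => simp
  | cons n l ih =>
    rw [List.foldl_cons, ih]
    ext i
    · by_cases h : κ n = i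
      · subst h; simp [add_assoc]
      · simp [h, Function.update_of_ne (Ne.symm h)]
    · by_cases h : κ n = i
      · subst h; simp [add_assoc]
      · simp [h, Function.update_of_ne (Ne.symm h)]

lemma val_levelSums (D : Model I N) (k : Fin 2) (θ : State I) :
    (D.levelSums k θ).val = (fun i => (D.occ k i : ℝ), D.resSum k (θ.2 k.rev)) := by
  rw [levelSums, Counted.val_foldlM]
  simp only [Counted.val_bind, val_op, Counted.val_pure]
  rw [show ((0, 0) : (Fin I → ℝ) × (Fin I → ℝ)) = (fun _ => 0, fun _ => 0) from rfl,
    foldl_update_add (fun _ => 1) (fun n => D.y n - θ.2 k.rev (D.lev k.rev n)) (D.lev k)]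
  ext i
  · simp [← Fin.sum_univ_def, occ]
  · simp [← Fin.sum_univ_def, resSum]

lemma ops_levelSums (D : Model I N) (k : Fin 2) (θ : State I) :
    (D.levelSums k θ).ops = 3 * N := by
  rw [levelSums, Counted.ops_foldlM _ (fun _ => 3) (by intros; simp)]
  simp [mul_comm]

lemma foldl_add_pair {β : Type} (f g : β → ℝ) (l : List β) (p q : ℝ) :
    l.foldl (fun (ph : ℝ × ℝ) n => (ph.1 + f n, ph.2 + g n)) (p, q) =
      (p + (l.map f).sum, q + (l.map g).sum) := by
  induction l generalizing p q with
  | nil => simp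
  | cons n l ih => simp [ih, add_assoc]

lemma val_globalParams (D : Model I N) (k : Fin 2) (b : Fin I → ℝ) :
    (D.globalParams k (fun i => (D.occ k i : ℝ)) (D.resSum k b)).val =
      (D.globalPrec k, D.tpr * D.μpr + ∑ i, D.levelWeight k i * D.resSum k b i) := by
  simp only [globalParams, Counted.val_bind, val_op, Counted.val_foldlM, Counted.val_pure]
  rw [foldl_add_pair (fun i => D.τ * D.τf k / (D.τf k + D.τ * D.occ k i) * D.occ k i)
    (fun i => D.τ * D.τf k / (D.τf k + D.τ * D.occ k i) * D.resSum k b i)]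
  simp [← Fin.sum_univ_def, globalPrec, levelWeight, levelPrec]

lemma ops_globalParams (D : Model I N) (k : Fin 2) (c s : Fin I → ℝ) :
    (D.globalParams k c s).ops = 1 + 8 * I := by
  rw [globalParams, Counted.ops_bind, Counted.ops_foldlM _ (fun _ => 8) (by intros; simp)]
  simp [mul_comm]

lemma foldl_update_apply {ι : Type} [DecidableEq ι] (x : ι → ℝ) (l : List ι) (a : ι → ℝ) (i : ι) :
    l.foldl (fun (a : ι → ℝ) i => Function.update a i (x i)) a i =
      if i ∈ l then x i else a i := by
  induction l generalizing a with
  | nil => simp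
  | cons j l ih =>
    rw [List.foldl_cons, ih]
    by_cases h : i ∈ l
    · simp [h]
    · by_cases hij : i = j
      · subst hij; simp
      · simp [h, hij]

lemma val_levelDraws (D : Model I N) (k : Fin 2) (b : Fin I → ℝ) (a₀ : ℝ) (z : Fin I → ℝ) :
    (D.levelDraws k (fun i => (D.occ k i : ℝ)) (D.resSum k b) a₀ z).val =
      fun i => D.levelMean k b a₀ i + z i / √(D.levelPrec k i) := by
  rw [levelDraws, Counted.val_foldlM]
  simp only [Counted.val_bind, val_op, Counted.val_pure, normalDraw]
  ext i
  rw [foldl_update_apply (fun i => D.τ * (D.resSum k b i - D.occ k i * a₀) /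
    (D.τf k + D.τ * D.occ k i) + z i / √(D.τf k + D.τ * D.occ k i))]
  simp [levelMean, levelPrec]

lemma ops_levelDraws (D : Model I N) (k : Fin 2) (c s : Fin I → ℝ) (a₀ : ℝ) (z : Fin I → ℝ) :
    (D.levelDraws k c s a₀ z).ops = 10 * I := by
  rw [levelDraws, Counted.ops_foldlM _ (fun _ => 10) (by intros; simp [normalDraw])]
  simp [mul_comm]

lemma val_blockProgram (D : Model I N) (k : Fin 2) (θ : State I) (z : Noise I) :
    (D.blockProgram k θ z).val = assemble k (D.blockDraw k (θ.2 k.rev) z) (θ.2 k.rev) := by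
  simp only [blockProgram, Counted.val_bind, Counted.val_pure, val_levelSums, val_globalParams,
    val_levelDraws, normalDraw, val_op]
  rfl

lemma ops_blockProgram (D : Model I N) (k : Fin 2) (θ : State I) (z : Noise I) :
    (D.blockProgram k θ z).ops = 3 * N + 18 * I + 6 := by
  simp only [blockProgram, Counted.ops_bind, Counted.ops_pure, ops_levelSums, ops_globalParams,
    ops_levelDraws, normalDraw, ops_op]
  ring

lemma costPerIteration_eq (D : Model I N) :
    D.costPerIteration = ((2 * (3 * N + 18 * I + 6) : ℕ) : ℝ≥0∞) := by
  have h : ∀ θ z, (D.gibbsProgram θ z).ops = 2 * (3 * N + 18 * I + 6) := by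
    intro θ z
    simp only [gibbsProgram, Counted.ops_bind, ops_blockProgram]
    ring
  simp only [costPerIteration, h, iSup_const]

/-! ### Completing the squares -/

lemma levelPrec_pos (D : Model I N) (hτ : 0 < D.τ) (hf : ∀ k, 0 < D.τf k) (k : Fin 2)
    (i : Fin I) : 0 < D.levelPrec k i := by
  have := hf k
  unfold levelPrec
  positivity

lemma globalPrec_pos (D : Model I N) (hτ : 0 < D.τ) (hf : ∀ k, 0 < D.τf k) (ht : 0 ≤ D.tpr)
    (hN : 0 < N) (k : Fin 2) : 0 < D.globalPrec k := by
  have hw : ∀ i, 0 < D.levelWeight k i := fun i =>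
    div_pos (mul_pos hτ (hf k)) (D.levelPrec_pos hτ hf k i)
  refine add_pos_of_nonneg_of_pos ht ?_
  refine Finset.sum_pos' (fun i _ => mul_nonneg (hw i).le (Nat.cast_nonneg _))
    ⟨D.lev k ⟨0, hN⟩, Finset.mem_univ _, mul_pos (hw _) ?_⟩
  rw [Nat.cast_pos, occ, Finset.card_pos]
  exact ⟨⟨0, hN⟩, by simp⟩

/-- The part of the log posterior density that depends on the effects of factor `k.rev` only. -/
noncomputable def marginalExponent (D : Model I N) (k : Fin 2) (b : Fin I → ℝ) : ℝ :=
  D.tpr * D.μpr ^ 2 + ∑ j, D.τf k.rev * b j ^ 2 + D.τ * ∑ n, (D.y n - b (D.lev k.rev n)) ^ 2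
    - ∑ i, D.τ ^ 2 * D.resSum k b i ^ 2 / D.levelPrec k i
    - D.globalPrec k * D.globalMean k b ^ 2

lemma sum_levels (D : Model I N) (k : Fin 2) (f : Fin N → Fin I → ℝ) :
    ∑ n, f n (D.lev k n) = ∑ i, ∑ n, if D.lev k n = i then f n i else 0 := by
  rw [Finset.sum_comm]
  simp

/-- The square is completed in each a_i for fixed a₀; what remains is quadratic in a₀, with
coefficient `globalPrec`, and is completed in turn. This is the order in which the program draws. -/
lemma complete_squares (D : Model I N) (hτ : 0 < D.τ) (hf : ∀ k, 0 < D.τf k) (ht : 0 ≤ D.tpr)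
    (hN : 0 < N) (k : Fin 2) (b : Fin I → ℝ) (a₀ : ℝ) (a : Fin I → ℝ) :
    D.tpr * (a₀ - D.μpr) ^ 2 + (∑ i, D.τf k * a i ^ 2 + ∑ i, D.τf k.rev * b i ^ 2) +
      D.τ * ∑ n, (D.y n - (a₀ + a (D.lev k n) + b (D.lev k.rev n))) ^ 2 =
    D.globalPrec k * (a₀ - D.globalMean k b) ^ 2 +
      ∑ i, D.levelPrec k i * (a i - D.levelMean k b a₀ i) ^ 2 + D.marginalExponent k b := by
  have hP := (D.globalPrec_pos hτ hf ht hN k).ne'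
  have hv : ∀ i, D.levelPrec k i ≠ 0 := fun i => (D.levelPrec_pos hτ hf k i).ne'
  set r : Fin N → ℝ := fun n => D.y n - b (D.lev k.rev n) with hr
  have hS : ∀ i, ∑ n, (if D.lev k n = i then r n else 0) = D.resSum k b i := fun i => rfl
  have hC : ∀ i, ∑ n, (if D.lev k n = i then (1 : ℝ) else 0) = D.occ k i := fun i => by
    simp [occ]
  have h1 : ∑ n, (D.y n - (a₀ + a (D.lev k n) + b (D.lev k.rev n))) ^ 2 =
      ∑ n, r n ^ 2 + ∑ i, (D.occ k i * (a₀ + a i) ^ 2 - 2 * D.resSum k b i * (a₀ + a i)) := by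
    have e : ∀ n, (D.y n - (a₀ + a (D.lev k n) + b (D.lev k.rev n))) ^ 2 = r n ^ 2 +
        (fun (n : Fin N) i => (a₀ + a i) ^ 2 - 2 * r n * (a₀ + a i)) n (D.lev k n) := by
      intro n; simp only [hr]; ring
    rw [Finset.sum_congr rfl fun n _ => e n, Finset.sum_add_distrib,
      D.sum_levels k fun n i => (a₀ + a i) ^ 2 - 2 * r n * (a₀ + a i)]
    congr 1
    refine Finset.sum_congr rfl fun i _ => ?_
    rw [← hS, ← hC, Finset.sum_mul, Finset.mul_sum, Finset.sum_mul, ← Finset.sum_sub_distrib]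
    refine Finset.sum_congr rfl fun n _ => ?_
    split_ifs <;> ring
  have h2 : ∀ i, D.τf k * a i ^ 2 +
      D.τ * (D.occ k i * (a₀ + a i) ^ 2 - 2 * D.resSum k b i * (a₀ + a i)) =
      D.levelPrec k i * (a i - D.levelMean k b a₀ i) ^ 2 +
      (D.levelWeight k i * D.occ k i) * a₀ ^ 2 - 2 * a₀ * (D.levelWeight k i * D.resSum k b i)
        - D.τ ^ 2 * D.resSum k b i ^ 2 / D.levelPrec k i := by
    intro i
    have := hv i
    rw [levelMean, levelWeight]
    -- Eliminating the prior precision leaves `levelPrec` as the only denominator.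
    have e : D.τf k = D.levelPrec k i - D.τ * D.occ k i := by rw [levelPrec]; ring
    rw [e]
    field_simp
    ring
  have h3 : D.globalPrec k * (a₀ - D.globalMean k b) ^ 2 =
      D.globalPrec k * a₀ ^ 2 - 2 * a₀ * (D.tpr * D.μpr + ∑ i, D.levelWeight k i * D.resSum k b i)
        + D.globalPrec k * D.globalMean k b ^ 2 := by
    have : D.globalPrec k * D.globalMean k b =
        D.tpr * D.μpr + ∑ i, D.levelWeight k i * D.resSum k b i := by
      rw [globalMean]; field_simp
    rw [← this]; ring
  have h4 := Finset.sum_congr (rfl : (Finset.univ : Finset (Fin I)) = _) fun i _ => h2 i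
  simp only [Finset.sum_add_distrib, Finset.sum_sub_distrib, ← Finset.mul_sum, ← Finset.sum_mul]
    at h4
  rw [h3, h1, marginalExponent]
  have h5 : D.globalPrec k = D.tpr + ∑ i, D.levelWeight k i * D.occ k i := rfl
  simp only [Finset.sum_sub_distrib, ← Finset.mul_sum] at h4 ⊢
  simp only [mul_add, mul_sub] at h4 ⊢
  rw [h5] at *
  linear_combination h4

lemma postWeight_assemble (D : Model I N) (hτ : 0 < D.τ) (hf : ∀ k, 0 < D.τf k)
    (ht : 0 ≤ D.tpr) (hN : 0 < N) (k : Fin 2) (u : ℝ × (Fin I → ℝ)) (b : Fin I → ℝ) :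
    D.postWeight (assemble k u b) = Real.exp (-D.marginalExponent k b / 2) *
      (Real.exp (-(D.globalPrec k * (u.1 - D.globalMean k b) ^ 2) / 2) *
        ∏ i, Real.exp (-(D.levelPrec k i * (u.2 i - D.levelMean k b u.1 i) ^ 2) / 2)) := by
  have h := D.complete_squares hτ hf ht hN k b u.1 u.2
  rw [postWeight, ← Real.exp_sum, ← Real.exp_sum, ← Real.exp_add, ← Real.exp_add, ← Real.exp_add]
  congr 1
  have h1 : ∑ l, ∑ i, D.τf l * (assemble k u b).2 l i ^ 2 =
      ∑ i, D.τf k * u.2 i ^ 2 + ∑ i, D.τf k.rev * b i ^ 2 := by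
    fin_cases k
    · simp [assemble, Fin.sum_univ_two]
    · simp [assemble, Fin.sum_univ_two, add_comm]
  have h2 : ∀ n, (assemble k u b).1 + (assemble k u b).2 0 (D.lev 0 n) +
      (assemble k u b).2 1 (D.lev 1 n) = u.1 + u.2 (D.lev k n) + b (D.lev k.rev n) := by
    intro n
    fin_cases k
    · simp [assemble]
    · simp [assemble]; ring
  simp only [h1, h2]
  rw [← Finset.sum_div, ← Finset.sum_div, Finset.sum_neg_distrib,
    ← Finset.mul_sum (f := fun n => (D.y n - (u.1 + u.2 (D.lev k n) + b (D.lev k.rev n))) ^ 2)]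
  simp only [assemble]
  linear_combination (-1 / 2) * h

end Model

/-! ### Lebesgue integrals of products and Gaussian densities -/

lemma lintegral_fin_prod_eq_prod {n : ℕ} {E : Type} [MeasureSpace E]
    [SigmaFinite (volume : Measure E)] (f : Fin n → E → ℝ≥0∞) (hf : ∀ i, Measurable (f i)) :
    ∫⁻ x : Fin n → E, ∏ i, f i (x i) = ∏ i, ∫⁻ x, f i x := by
  induction n with
  | zero =>
    simp only [Finset.univ_eq_empty, Finset.prod_empty, lintegral_one]
    rw [volume_pi, Measure.pi_univ]
    simp
  | succ n ih =>
    rw [← ((volume_preserving_piFinSuccAbove (fun _ => E) 0).symm).lintegral_comp_emb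
      (MeasurableEquiv.measurableEmbedding _)]
    simp_rw [MeasurableEquiv.piFinSuccAbove_symm_apply, Fin.insertNthEquiv,
      Fin.prod_univ_succ, Fin.insertNth_zero, Equiv.coe_fn_mk, Fin.cons_succ, Fin.cons_zero]
    have hm : Measurable fun x : Fin n → E => ∏ i : Fin n, f i.succ (x i) := by
      apply Finset.measurable_fun_prod
      intro i _
      exact (hf _).comp (measurable_pi_apply i)
    rw [← ih _ fun i => hf i.succ]
    exact lintegral_prod_mul (hf 0).aemeasurable hm.aemeasurable

lemma pi_withDensity {n : ℕ} (f : Fin n → ℝ → ℝ≥0∞) (hf : ∀ i, Measurable (f i))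
    [∀ i, SigmaFinite ((volume : Measure ℝ).withDensity (f i))] :
    Measure.pi (fun i => (volume : Measure ℝ).withDensity (f i)) =
      (volume : Measure (Fin n → ℝ)).withDensity fun x => ∏ i, f i (x i) := by
  refine Measure.pi_eq fun s hs => ?_
  rw [withDensity_apply _ (MeasurableSet.univ_pi hs),
    ← lintegral_indicator (MeasurableSet.univ_pi hs)]
  have h : ∀ x : Fin n → ℝ, (Set.univ.pi s).indicator (fun x => ∏ i, f i (x i)) x =
      ∏ i, (s i).indicator (f i) (x i) := by
    intro x
    by_cases hx : x ∈ Set.univ.pi s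
    · rw [Set.indicator_of_mem hx]
      exact Finset.prod_congr rfl fun i _ => (Set.indicator_of_mem (hx i trivial) _).symm
    · rw [Set.indicator_of_notMem hx]
      simp only [Set.mem_pi, Set.mem_univ, true_imp_iff, not_forall] at hx
      obtain ⟨i, hi⟩ := hx
      exact (Finset.prod_eq_zero (Finset.mem_univ i) (Set.indicator_of_notMem hi _)).symm
  simp_rw [h]
  rw [lintegral_fin_prod_eq_prod _ fun i => (hf i).indicator (hs i)]
  exact Finset.prod_congr rfl fun i _ => by
    rw [lintegral_indicator (hs i), withDensity_apply _ (hs i)]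

/-- The mass of an unnormalized normal density with precision `v`. -/
noncomputable def gaussMass (v : ℝ) : ℝ≥0∞ := ENNReal.ofReal (√(2 * Real.pi / v))

lemma gaussMass_ne_top (v : ℝ) : gaussMass v ≠ ∞ := ENNReal.ofReal_ne_top

lemma measurable_exp_quadratic (v m : ℝ) :
    Measurable fun x : ℝ => ENNReal.ofReal (Real.exp (-(v * (x - m) ^ 2) / 2)) := by
  fun_prop

/-- Expressing the Gaussian weight as a pushforward of standard noise lets densities be compared
directly with the output of the program. -/
lemma withDensity_exp_quadratic {v : ℝ} (hv : 0 < v) (m : ℝ) :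
    (volume : Measure ℝ).withDensity
      (fun x => ENNReal.ofReal (Real.exp (-(v * (x - m) ^ 2) / 2))) =
      gaussMass v • (gaussianReal 0 1).map fun z => m + z / √v := by
  have h1 : (gaussianReal 0 1).map (fun z => m + z / √v) = gaussianReal m (Real.toNNReal v⁻¹) := by
    rw [show (fun z : ℝ => m + z / √v) = (fun z => m + z) ∘ fun z => z / √v from rfl,
      ← Measure.map_map (by fun_prop) (by fun_prop), gaussianReal_map_div_const,
      gaussianReal_map_const_add]
    congr 1
    · simp
    · ext
      simp [Real.sq_sqrt hv.le, hv.le]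
  have hv' : Real.toNNReal v⁻¹ ≠ 0 := by
    rw [Ne, Real.toNNReal_eq_zero, not_le]; positivity
  rw [h1, gaussianReal_of_var_ne_zero _ hv', ← withDensity_smul _ (measurable_gaussianPDF _ _)]
  congr 1
  ext x
  rw [Pi.smul_apply, smul_eq_mul, gaussMass, gaussianPDF, ← ENNReal.ofReal_mul (by positivity),
    gaussianPDFReal, Real.coe_toNNReal _ (by positivity : (0 : ℝ) ≤ v⁻¹), ← mul_assoc,
    ← div_eq_mul_inv (2 * Real.pi) v, mul_inv_cancel₀ (by positivity), one_mul]
  congr 2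
  field_simp

lemma lintegral_exp_quadratic_mul {v : ℝ} (hv : 0 < v) (m : ℝ) {G : ℝ → ℝ≥0∞}
    (hG : Measurable G) :
    ∫⁻ x, ENNReal.ofReal (Real.exp (-(v * (x - m) ^ 2) / 2)) * G x =
      gaussMass v * ∫⁻ z, G (m + z / √v) ∂(gaussianReal 0 1) := by
  rw [← lintegral_map hG (by fun_prop : Measurable fun z : ℝ => m + z / √v), ← smul_eq_mul,
    ← lintegral_smul_measure, ← withDensity_exp_quadratic hv,
    lintegral_withDensity_eq_lintegral_mul _ (measurable_exp_quadratic v m) hG]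
  rfl

lemma lintegral_exp_quadratic {v : ℝ} (hv : 0 < v) (m : ℝ) :
    ∫⁻ x, ENNReal.ofReal (Real.exp (-(v * (x - m) ^ 2) / 2)) = gaussMass v := by
  simpa using lintegral_exp_quadratic_mul hv m (G := fun _ => 1) measurable_const

lemma lintegral_prod_exp_quadratic_mul {n : ℕ} {v : Fin n → ℝ} (hv : ∀ i, 0 < v i)
    (m : Fin n → ℝ) {G : (Fin n → ℝ) → ℝ≥0∞} (hG : Measurable G) :
    ∫⁻ x, (∏ i, ENNReal.ofReal (Real.exp (-(v i * (x i - m i) ^ 2) / 2))) * G x =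
      (∏ i, gaussMass (v i)) *
        ∫⁻ z, G (fun i => m i + z i / √(v i)) ∂(Measure.pi fun _ => gaussianReal 0 1) := by
  have hsf : ∀ i, IsFiniteMeasure ((volume : Measure ℝ).withDensity
      (fun x => ENNReal.ofReal (Real.exp (-(v i * (x - m i) ^ 2) / 2)))) := fun i => by
    rw [withDensity_exp_quadratic (hv i)]
    exact Measure.smul_finite _ (gaussMass_ne_top _)
  have hprob : ∀ i, IsProbabilityMeasure
      ((gaussianReal 0 1).map fun z : ℝ => m i + z / √(v i)) := fun i =>
    Measure.isProbabilityMeasure_map (by fun_prop)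
  have hmeas : (volume : Measure (Fin n → ℝ)).withDensity
      (fun x => ∏ i, ENNReal.ofReal (Real.exp (-(v i * (x i - m i) ^ 2) / 2))) =
      (∏ i, gaussMass (v i)) •
        (Measure.pi fun _ => gaussianReal 0 1).map fun z i => m i + z i / √(v i) := by
    rw [← pi_withDensity _ fun i => measurable_exp_quadratic (v i) (m i),
      Measure.pi_map_pi (f := fun i z => m i + z / √(v i)) (fun i => by fun_prop)]
    refine Measure.pi_eq fun s hs => ?_
    rw [Measure.smul_apply, Measure.pi_pi, smul_eq_mul, ← Finset.prod_mul_distrib]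
    refine Finset.prod_congr rfl fun i _ => ?_
    rw [withDensity_exp_quadratic (hv i), Measure.smul_apply, smul_eq_mul]
  have hm : Measurable fun x : Fin n → ℝ =>
      ∏ i, ENNReal.ofReal (Real.exp (-(v i * (x i - m i) ^ 2) / 2)) := by
    apply Finset.measurable_fun_prod
    intro i _
    exact (measurable_exp_quadratic (v i) (m i)).comp (measurable_pi_apply i)
  rw [← lintegral_map hG (by fun_prop : Measurable fun (z : Fin n → ℝ) i => m i + z i / √(v i)),
    ← smul_eq_mul, ← lintegral_smul_measure, ← hmeas,
    lintegral_withDensity_eq_lintegral_mul _ hm hG]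
  rfl

namespace Model

variable {I N : ℕ}

/-! ### The posterior law in block coordinates -/

/-- A state in block coordinates: the effects of factor `k.rev`, and the block of factor `k`. -/
def toBlocks (k : Fin 2) (θ : State I) : (Fin I → ℝ) × (ℝ × (Fin I → ℝ)) :=
  (θ.2 k.rev, (θ.1, θ.2 k))

lemma measurable_toBlocks (k : Fin 2) : Measurable (toBlocks (I := I) k) := by
  unfold toBlocks; fun_prop

lemma measurable_assemble (k : Fin 2) :
    Measurable fun x : (ℝ × (Fin I → ℝ)) × (Fin I → ℝ) => assemble k x.1 x.2 := by
  unfold assemble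
  refine (measurable_fst.comp measurable_fst).prodMk (measurable_pi_lambda _ fun l => ?_)
  split_ifs
  · exact measurable_snd.comp measurable_fst
  · exact measurable_snd

lemma assemble_toBlocks (k : Fin 2) (θ : State I) :
    assemble k (θ.1, θ.2 k) (θ.2 k.rev) = θ := by
  unfold assemble
  ext l
  · rfl
  · fin_cases k <;> fin_cases l <;> simp

lemma measurePreserving_toBlocks (k : Fin 2) :
    MeasurePreserving (toBlocks (I := I) k) volume volume := by
  have h1 : MeasurePreserving (Prod.map id (MeasurableEquiv.piFinTwo fun _ => (Fin I → ℝ)))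
      (volume : Measure (State I)) volume :=
    (MeasurePreserving.id _).prod (volume_preserving_piFinTwo _)
  fin_cases k
  · have h2 := (volume_preserving_prodAssoc (α₁ := ℝ) (β₁ := Fin I → ℝ) (γ₁ := Fin I → ℝ)).symm
    exact (Measure.measurePreserving_swap.comp h2).comp h1
  · have h3 : MeasurePreserving (Prod.map id Prod.swap) (volume : Measure
        (ℝ × ((Fin I → ℝ) × (Fin I → ℝ)))) volume :=
      (MeasurePreserving.id _).prod Measure.measurePreserving_swap
    have h2 := (volume_preserving_prodAssoc (α₁ := ℝ) (β₁ := Fin I → ℝ) (γ₁ := Fin I → ℝ)).symm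
    exact ((Measure.measurePreserving_swap.comp h2).comp h3).comp h1

lemma measurable_postWeight (D : Model I N) : Measurable D.postWeight := by
  unfold postWeight
  refine Measurable.mul (by fun_prop) (Finset.measurable_fun_prod _ fun n _ => by fun_prop)

lemma measurable_resSum (D : Model I N) (k : Fin 2) (i : Fin I) :
    Measurable fun b : Fin I → ℝ => D.resSum k b i := by
  unfold resSum
  refine Finset.measurable_fun_sum _ fun n _ => ?_
  split_ifs <;> fun_prop

instance : IsProbabilityMeasure (noiseLaw I) := by unfold noiseLaw; infer_instance

/-- The density of the effects of factor `k.rev`, up to normalization. -/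
noncomputable def marginalWeight (D : Model I N) (k : Fin 2) (b : Fin I → ℝ) : ℝ≥0∞ :=
  ENNReal.ofReal (Real.exp (-D.marginalExponent k b / 2)) *
    (gaussMass (D.globalPrec k) * ∏ i, gaussMass (D.levelPrec k i))

lemma measurable_globalMean (D : Model I N) (k : Fin 2) :
    Measurable fun b : Fin I → ℝ => D.globalMean k b := by
  have hr := D.measurable_resSum k
  unfold globalMean
  fun_prop

lemma measurable_levelMean (D : Model I N) (k : Fin 2) (i : Fin I) :
    Measurable fun p : (Fin I → ℝ) × ℝ => D.levelMean k p.1 p.2 i := by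
  have hr := D.measurable_resSum k i
  unfold levelMean
  fun_prop

lemma measurable_blockDraw (D : Model I N) (k : Fin 2) :
    Measurable fun p : (Fin I → ℝ) × Noise I => D.blockDraw k p.1 p.2 := by
  have hg := D.measurable_globalMean k
  have h0 : Measurable fun p : (Fin I → ℝ) × Noise I =>
      D.globalMean k p.1 + p.2.1 / √(D.globalPrec k) := by fun_prop
  unfold blockDraw
  refine h0.prodMk (measurable_pi_lambda _ fun i => ?_)
  have := (D.measurable_levelMean k i).comp (measurable_fst.prodMk h0)
  exact this.add (by fun_prop)

lemma lintegral_postWeight_levels (D : Model I N) (hτ : 0 < D.τ) (hf : ∀ k, 0 < D.τf k)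
    (ht : 0 ≤ D.tpr) (hN : 0 < N) (k : Fin 2) (b : Fin I → ℝ) (a₀ : ℝ)
    {G : (Fin I → ℝ) → ℝ≥0∞} (hG : Measurable G) :
    ∫⁻ a, ENNReal.ofReal (D.postWeight (assemble k (a₀, a) b)) * G a =
      ENNReal.ofReal (Real.exp (-(D.globalPrec k * (a₀ - D.globalMean k b) ^ 2) / 2)) *
      (ENNReal.ofReal (Real.exp (-D.marginalExponent k b / 2)) *
        ((∏ i, gaussMass (D.levelPrec k i)) *
          ∫⁻ z, G (fun i => D.levelMean k b a₀ i + z i / √(D.levelPrec k i))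
            ∂(Measure.pi fun _ => gaussianReal 0 1))) := by
  have hv := D.levelPrec_pos hτ hf k
  have hm : Measurable fun a : Fin I → ℝ => (∏ i, ENNReal.ofReal (Real.exp
      (-(D.levelPrec k i * (a i - D.levelMean k b a₀ i) ^ 2) / 2))) * G a := by
    refine (Finset.measurable_fun_prod _ fun i _ => ?_).mul hG
    exact (measurable_exp_quadratic _ _).comp (measurable_pi_apply i)
  rw [← lintegral_prod_exp_quadratic_mul hv (D.levelMean k b a₀) hG, ← lintegral_const_mul _ hm,
    ← lintegral_const_mul _ (hm.const_mul _)]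
  refine lintegral_congr fun a => ?_
  rw [D.postWeight_assemble hτ hf ht hN, ENNReal.ofReal_mul (Real.exp_nonneg _),
    ENNReal.ofReal_mul (Real.exp_nonneg _),
    ENNReal.ofReal_prod_of_nonneg fun _ _ => Real.exp_nonneg _]
  ring

/-- Tonelli with the level effects integrated first, for fixed a₀, and then a₀. The block law is
thereby separated from a factor that depends on b alone. -/
lemma lintegral_postWeight_block (D : Model I N) (hτ : 0 < D.τ) (hf : ∀ k, 0 < D.τf k)
    (ht : 0 ≤ D.tpr) (hN : 0 < N) (k : Fin 2) (b : Fin I → ℝ) {G : ℝ × (Fin I → ℝ) → ℝ≥0∞}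
    (hG : Measurable G) :
    ∫⁻ u, ENNReal.ofReal (D.postWeight (assemble k u b)) * G u =
      D.marginalWeight k b * ∫⁻ z, G (D.blockDraw k b z) ∂(noiseLaw I) := by
  have hP := D.globalPrec_pos hτ hf ht hN k
  have hw : Measurable fun u => ENNReal.ofReal (D.postWeight (assemble k u b)) * G u := by
    have : Measurable fun u : ℝ × (Fin I → ℝ) => assemble k u b :=
      (measurable_assemble k).comp (measurable_id.prodMk measurable_const)
    exact (D.measurable_postWeight.comp this).ennreal_ofReal.mul hG
  have hdr : Measurable (D.blockDraw k b) := (D.measurable_blockDraw k).of_uncurry_left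
  have hGd : Measurable fun z => G (D.blockDraw k b z) := hG.comp hdr
  have hinner : Measurable fun p : ℝ × (Fin I → ℝ) =>
      G (p.1, fun i => D.levelMean k b p.1 i + p.2 i / √(D.levelPrec k i)) := by
    refine hG.comp (measurable_fst.prodMk (measurable_pi_lambda _ fun i => ?_))
    have h1 : Measurable fun a₀ => D.levelMean k b a₀ i := by
      unfold levelMean; fun_prop
    have h2 : Measurable fun p : ℝ × (Fin I → ℝ) => D.levelMean k b p.1 i :=
      h1.comp measurable_fst
    exact h2.add (by fun_prop)
  have hint := hinner.lintegral_prod_right' (ν := Measure.pi fun _ => gaussianReal 0 1)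
  have hint' := hint.comp (by fun_prop : Measurable fun z : ℝ =>
    D.globalMean k b + z / √(D.globalPrec k))
  simp only [Function.comp_def] at hint'
  rw [Measure.volume_eq_prod, lintegral_prod _ hw.aemeasurable, noiseLaw,
    lintegral_prod _ hGd.aemeasurable]
  rw [lintegral_congr fun a₀ => D.lintegral_postWeight_levels hτ hf ht hN k b a₀
    (G := fun a => G (a₀, a)) (hG.comp measurable_prodMk_left), lintegral_exp_quadratic_mul hP _
    ((hint.const_mul _).const_mul _), lintegral_const_mul _ (hint'.const_mul _),
    lintegral_const_mul _ hint', marginalWeight]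
  simp only [blockDraw]
  ring

/-! ### Moments of the posterior law -/

/-- The prior quadratic form of the factor effects. -/
noncomputable def effectEnergy (D : Model I N) (θ : State I) : ℝ :=
  ∑ k, ∑ i, D.τf k * θ.2 k i ^ 2

lemma effectEnergy_nonneg (D : Model I N) (hf : ∀ k, 0 < D.τf k) (θ : State I) :
    0 ≤ D.effectEnergy θ :=
  Finset.sum_nonneg fun k _ => Finset.sum_nonneg fun _ _ => mul_nonneg (hf k).le (sq_nonneg _)

lemma measurable_effectEnergy (D : Model I N) : Measurable D.effectEnergy := by
  unfold effectEnergy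
  fun_prop

/-- Under a flat prior only the likelihood controls a⁽⁰⁾, so one observation is kept for it and the
others are bounded by 1. The prior factor exp(-E/2) is split in two: one half absorbs 1 + E, the
other keeps the effects integrable. -/
lemma one_add_effectEnergy_mul_postWeight_le (D : Model I N) (hτ : 0 < D.τ)
    (hf : ∀ k, 0 < D.τf k) (ht : 0 ≤ D.tpr) (n : Fin N) (θ : State I) :
    (1 + D.effectEnergy θ) * D.postWeight θ ≤ 5 *
      (Real.exp (-(D.τ * (θ.1 - (D.y n - θ.2 0 (D.lev 0 n) - θ.2 1 (D.lev 1 n))) ^ 2) / 2) *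
        ∏ k, ∏ i, Real.exp (-(D.τf k / 2 * (θ.2 k i - 0) ^ 2) / 2)) := by
  set E := D.effectEnergy θ with hE
  have hE0 : 0 ≤ E := D.effectEnergy_nonneg hf θ
  have h1 : ∏ k, ∏ i, Real.exp (-(D.τf k / 2 * (θ.2 k i - 0) ^ 2) / 2) = Real.exp (-E / 4) := by
    simp_rw [← Real.exp_sum]
    congr 1
    rw [hE, effectEnergy, neg_div, Finset.sum_div, ← Finset.sum_neg_distrib]
    refine Finset.sum_congr rfl fun k _ => ?_
    rw [Finset.sum_div, ← Finset.sum_neg_distrib]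
    refine Finset.sum_congr rfl fun i _ => ?_
    ring
  have h2 : ∏ m, Real.exp (-D.τ * (D.y m - (θ.1 + θ.2 0 (D.lev 0 m) + θ.2 1 (D.lev 1 m))) ^ 2 / 2)
      ≤ Real.exp (-(D.τ * (θ.1 - (D.y n - θ.2 0 (D.lev 0 n) - θ.2 1 (D.lev 1 n))) ^ 2) / 2) := by
    rw [← Finset.mul_prod_erase _ _ (Finset.mem_univ n)]
    refine (mul_le_of_le_one_right (Real.exp_nonneg _) ?_).trans_eq ?_
    · refine Finset.prod_le_one (fun _ _ => Real.exp_nonneg _) fun m _ => ?_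
      rw [Real.exp_le_one_iff]
      have := mul_nonneg hτ.le
        (sq_nonneg (D.y m - (θ.1 + θ.2 0 (D.lev 0 m) + θ.2 1 (D.lev 1 m))))
      linarith
    · congr 1; ring
  have h3 : Real.exp (-(D.tpr * (θ.1 - D.μpr) ^ 2 + ∑ k, ∑ i, D.τf k * θ.2 k i ^ 2) / 2) ≤
      Real.exp (-E / 4) * Real.exp (-E / 4) := by
    rw [← Real.exp_add, Real.exp_le_exp]
    have := mul_nonneg ht (sq_nonneg (θ.1 - D.μpr))
    change -(D.tpr * (θ.1 - D.μpr) ^ 2 + E) / 2 ≤ _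
    linarith
  have h4 : (1 + E) * Real.exp (-E / 4) ≤ 5 := by
    have h5 := Real.add_one_le_exp (E / 4)
    have h6 : Real.exp (-E / 4) * Real.exp (E / 4) = 1 := by rw [← Real.exp_add]; simp [neg_div]
    have h7 := Real.exp_pos (-E / 4)
    have h8 : 1 ≤ Real.exp (E / 4) := Real.one_le_exp (by positivity)
    calc (1 + E) * Real.exp (-E / 4) ≤ (5 * Real.exp (E / 4)) * Real.exp (-E / 4) := by
          gcongr; linarith
      _ = 5 := by rw [mul_assoc, mul_comm (Real.exp (E / 4)), h6, mul_one]
  rw [h1, postWeight]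
  set R := Real.exp (-(D.τ * (θ.1 - (D.y n - θ.2 0 (D.lev 0 n) - θ.2 1 (D.lev 1 n))) ^ 2) / 2)
  calc _ ≤ (1 + E) * ((Real.exp (-E / 4) * Real.exp (-E / 4)) * R) := by gcongr
    _ = ((1 + E) * Real.exp (-E / 4)) * (R * Real.exp (-E / 4)) := by ring
    _ ≤ _ := by gcongr

lemma lintegral_one_add_effectEnergy_lt_top (D : Model I N) (hτ : 0 < D.τ)
    (hf : ∀ k, 0 < D.τf k) (ht : 0 ≤ D.tpr) (hN : 0 < N) :
    ∫⁻ θ, ENNReal.ofReal ((1 + D.effectEnergy θ) * D.postWeight θ) < ∞ := by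
  set n : Fin N := ⟨0, hN⟩
  let r : (Fin 2 → Fin I → ℝ) → ℝ := fun a => D.y n - a 0 (D.lev 0 n) - a 1 (D.lev 1 n)
  let g : Fin 2 → (Fin I → ℝ) → ℝ≥0∞ := fun k x =>
    ∏ i, ENNReal.ofReal (Real.exp (-(D.τf k / 2 * (x i - 0) ^ 2) / 2))
  have hr : Measurable r := by fun_prop
  have hg : ∀ k, Measurable (g k) := fun k =>
    Finset.measurable_fun_prod _ fun i _ =>
      (measurable_exp_quadratic _ _).comp (measurable_pi_apply i)
  have hgp : Measurable fun a : Fin 2 → Fin I → ℝ => ∏ k, g k (a k) :=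
    Finset.measurable_fun_prod _ fun k _ => (hg k).comp (measurable_pi_apply k)
  have hle : ∀ θ : State I, ENNReal.ofReal ((1 + D.effectEnergy θ) * D.postWeight θ) ≤
      ENNReal.ofReal 5 * (ENNReal.ofReal (Real.exp (-(D.τ * (θ.1 - r θ.2) ^ 2) / 2)) *
        ∏ k, g k (θ.2 k)) := by
    intro θ
    refine (ENNReal.ofReal_le_ofReal
      (D.one_add_effectEnergy_mul_postWeight_le hτ hf ht n θ)).trans_eq ?_
    rw [ENNReal.ofReal_mul (by norm_num), ENNReal.ofReal_mul (Real.exp_nonneg _),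
      ENNReal.ofReal_prod_of_nonneg fun _ _ => Finset.prod_nonneg fun _ _ => Real.exp_nonneg _]
    simp only [g, ENNReal.ofReal_prod_of_nonneg fun _ _ => Real.exp_nonneg _]
    rfl
  have hm : Measurable fun θ : State I =>
      ENNReal.ofReal (Real.exp (-(D.τ * (θ.1 - r θ.2) ^ 2) / 2)) * ∏ k, g k (θ.2 k) := by
    refine Measurable.mul ?_ (hgp.comp measurable_snd)
    fun_prop
  refine (lintegral_mono hle).trans_lt ?_
  -- Integrating a⁽⁰⁾ first removes the dependence on the centre r, by translation invariance; the
  -- rest is a product over levels.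
  rw [lintegral_const_mul _ hm, Measure.volume_eq_prod, lintegral_prod_symm _ hm.aemeasurable]
  have h1 : ∀ a : Fin 2 → Fin I → ℝ,
      ∫⁻ x : ℝ, ENNReal.ofReal (Real.exp (-(D.τ * (x - r a) ^ 2) / 2)) * ∏ k, g k (a k) =
        gaussMass D.τ * ∏ k, g k (a k) := by
    intro a
    rw [lintegral_mul_const _ (measurable_exp_quadratic _ _), lintegral_exp_quadratic hτ]
  simp only [h1]
  rw [lintegral_const_mul _ hgp, lintegral_fin_prod_eq_prod _ hg]
  refine ENNReal.mul_lt_top ENNReal.ofReal_lt_top (ENNReal.mul_lt_top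
    (gaussMass_ne_top _).lt_top (ENNReal.prod_lt_top fun k _ => ?_))
  rw [lintegral_fin_prod_eq_prod _ fun i => measurable_exp_quadratic _ _]
  refine ENNReal.prod_lt_top fun i _ => ?_
  rw [lintegral_exp_quadratic (half_pos (hf k))]
  exact (gaussMass_ne_top _).lt_top

/-- The measure with the unnormalized posterior density. -/
noncomputable def postMeasure (D : Model I N) : Measure (State I) :=
  volume.withDensity fun θ => ENNReal.ofReal (D.postWeight θ)

lemma postWeight_pos (D : Model I N) (θ : State I) : 0 < D.postWeight θ :=
  mul_pos (Real.exp_pos _) (Finset.prod_pos fun _ _ => Real.exp_pos _)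

lemma postMeasure_univ_ne_zero (D : Model I N) : D.postMeasure Set.univ ≠ 0 := by
  rw [postMeasure, withDensity_apply _ MeasurableSet.univ, Measure.restrict_univ,
    ← pos_iff_ne_zero, lintegral_pos_iff_support D.measurable_postWeight.ennreal_ofReal]
  have h : (Function.support fun θ => ENNReal.ofReal (D.postWeight θ)) = Set.univ :=
    Set.eq_univ_of_forall fun θ => (ENNReal.ofReal_pos.2 (D.postWeight_pos θ)).ne'
  rw [h]
  exact isOpen_univ.measure_pos volume Set.univ_nonempty

lemma postMeasure_univ_ne_top (D : Model I N) (hτ : 0 < D.τ)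
    (hf : ∀ k, 0 < D.τf k) (ht : 0 ≤ D.tpr) (hN : 0 < N) : D.postMeasure Set.univ ≠ ∞ := by
  rw [postMeasure, withDensity_apply _ MeasurableSet.univ, Measure.restrict_univ]
  refine ((lintegral_mono fun θ => ENNReal.ofReal_le_ofReal ?_).trans_lt
    (D.lintegral_one_add_effectEnergy_lt_top hτ hf ht hN)).ne
  exact le_mul_of_one_le_left (D.postWeight_pos θ).le
    (le_add_of_nonneg_right (D.effectEnergy_nonneg hf θ))

lemma posterior_eq_smul (D : Model I N) :
    D.posterior = (D.postMeasure Set.univ)⁻¹ • D.postMeasure := by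
  rw [posterior, ProbabilityTheory.cond, Measure.restrict_univ]
  rfl

lemma isProbabilityMeasure_posterior (D : Model I N) (hτ : 0 < D.τ)
    (hf : ∀ k, 0 < D.τf k) (ht : 0 ≤ D.tpr) (hN : 0 < N) : IsProbabilityMeasure D.posterior := by
  constructor
  rw [posterior_eq_smul, Measure.smul_apply, smul_eq_mul]
  exact ENNReal.inv_mul_cancel D.postMeasure_univ_ne_zero
    (D.postMeasure_univ_ne_top hτ hf ht hN)

lemma lintegral_posterior (D : Model I N) {F : State I → ℝ≥0∞} (hF : Measurable F) :
    ∫⁻ θ, F θ ∂D.posterior =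
      (D.postMeasure Set.univ)⁻¹ * ∫⁻ θ, ENNReal.ofReal (D.postWeight θ) * F θ := by
  rw [posterior_eq_smul, lintegral_smul_measure, smul_eq_mul, postMeasure,
    lintegral_withDensity_eq_lintegral_mul _ D.measurable_postWeight.ennreal_ofReal hF]
  rfl

lemma lintegral_effectEnergy_posterior_lt_top (D : Model I N) (hτ : 0 < D.τ)
    (hf : ∀ k, 0 < D.τf k) (ht : 0 ≤ D.tpr) (hN : 0 < N) :
    ∫⁻ θ, ENNReal.ofReal (D.effectEnergy θ) ∂D.posterior < ∞ := by
  rw [lintegral_posterior _ D.measurable_effectEnergy.ennreal_ofReal]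
  refine ENNReal.mul_lt_top (ENNReal.inv_lt_top.2 (pos_iff_ne_zero.2 D.postMeasure_univ_ne_zero))
    ((lintegral_mono fun θ => ?_).trans_lt (D.lintegral_one_add_effectEnergy_lt_top hτ hf ht hN))
  have h := D.effectEnergy_nonneg hf θ
  rw [mul_comm, ← ENNReal.ofReal_mul h]
  exact ENNReal.ofReal_le_ofReal (mul_le_mul_of_nonneg_right (by linarith) (D.postWeight_pos θ).le)

/-! ### Exactness of the block programs -/

/-- The law of the block drawn by the program of factor `k`, given the other factor. -/
noncomputable def drawKernel (D : Model I N) (k : Fin 2) :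
    Kernel (Fin I → ℝ) (ℝ × (Fin I → ℝ)) :=
  (Kernel.id ×ₖ Kernel.const _ (noiseLaw I)).map fun p => D.blockDraw k p.1 p.2

lemma drawKernel_apply (D : Model I N) (k : Fin 2) (b : Fin I → ℝ) :
    D.drawKernel k b = (noiseLaw I).map (D.blockDraw k b) := by
  rw [drawKernel, Kernel.map_apply _ (D.measurable_blockDraw k), Kernel.prod_apply,
    Kernel.id_apply, Kernel.const_apply, Measure.dirac_prod,
    Measure.map_map (D.measurable_blockDraw k) measurable_prodMk_left]
  rfl

instance (D : Model I N) (k : Fin 2) : IsMarkovKernel (D.drawKernel k) :=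
  Kernel.IsMarkovKernel.map _ (D.measurable_blockDraw k)

lemma lintegral_posterior_toBlocks (D : Model I N) (hτ : 0 < D.τ)
    (hf : ∀ k, 0 < D.τf k) (ht : 0 ≤ D.tpr) (hN : 0 < N) (k : Fin 2)
    {F : (Fin I → ℝ) × (ℝ × (Fin I → ℝ)) → ℝ≥0∞} (hF : Measurable F) :
    ∫⁻ θ, F (toBlocks k θ) ∂D.posterior = (D.postMeasure Set.univ)⁻¹ *
      ∫⁻ b, D.marginalWeight k b * ∫⁻ u, F (b, u) ∂(D.drawKernel k b) := by
  have hw : Measurable fun x : (Fin I → ℝ) × (ℝ × (Fin I → ℝ)) =>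
      ENNReal.ofReal (D.postWeight (assemble k x.2 x.1)) * F x := by
    refine Measurable.mul ?_ hF
    exact (D.measurable_postWeight.comp ((measurable_assemble k).comp
      measurable_swap)).ennreal_ofReal
  rw [D.lintegral_posterior (F := fun θ => F (toBlocks k θ)) (hF.comp (measurable_toBlocks k))]
  congr 1
  have h1 : ∀ θ : State I, ENNReal.ofReal (D.postWeight θ) * F (toBlocks k θ) =
      (fun x : (Fin I → ℝ) × (ℝ × (Fin I → ℝ)) =>
        ENNReal.ofReal (D.postWeight (assemble k x.2 x.1)) * F x) (toBlocks k θ) := by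
    intro θ
    simp only [toBlocks, assemble_toBlocks]
  rw [lintegral_congr h1, (measurePreserving_toBlocks k).lintegral_comp hw,
    Measure.volume_eq_prod, lintegral_prod _ hw.aemeasurable]
  refine lintegral_congr fun b => ?_
  have hFb : Measurable fun u => F (b, u) := hF.comp measurable_prodMk_left
  rw [drawKernel_apply, lintegral_map hFb (D.measurable_blockDraw k).of_uncurry_left]
  exact D.lintegral_postWeight_block hτ hf ht hN k b hFb

/-- The block formula is applied to F and to its average over `drawKernel`. The kernel is Markov, so
the second application reproduces the first, and the marginal of the kept effects never has to be
normalized. -/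
lemma posterior_map_toBlocks (D : Model I N) (hτ : 0 < D.τ)
    (hf : ∀ k, 0 < D.τf k) (ht : 0 ≤ D.tpr) (hN : 0 < N) (k : Fin 2) :
    D.posterior.map (toBlocks k) =
      D.posterior.map (fun θ : State I => θ.2 k.rev) ⊗ₘ D.drawKernel k := by
  have hpr : Measurable fun θ : State I => θ.2 k.rev := by fun_prop
  refine Measure.ext_of_lintegral _ fun F hF => ?_
  have hF' : Measurable fun b => ∫⁻ u, F (b, u) ∂(D.drawKernel k b) :=
    hF.lintegral_kernel_prod_right'
  rw [lintegral_map hF (measurable_toBlocks k), Measure.lintegral_compProd hF,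
    lintegral_map hF' hpr, D.lintegral_posterior_toBlocks hτ hf ht hN k hF]
  have := D.lintegral_posterior_toBlocks hτ hf ht hN k
    (F := fun x => ∫⁻ u, F (x.1, u) ∂(D.drawKernel k x.1)) (hF'.comp measurable_fst)
  simp only [lintegral_const, measure_univ, mul_one] at this
  exact this.symm

lemma condDistrib_ae_eq_drawKernel (D : Model I N) (hτ : 0 < D.τ)
    (hf : ∀ k, 0 < D.τf k) (ht : 0 ≤ D.tpr) (hN : 0 < N) (k : Fin 2) :
    condDistrib (fun θ : State I => (θ.1, θ.2 k)) (fun θ : State I => θ.2 k.rev) D.posterior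
      =ᵐ[D.posterior.map fun θ : State I => θ.2 k.rev] D.drawKernel k :=
  condDistrib_ae_eq_of_measure_eq_compProd _ (by fun_prop)
    (D.posterior_map_toBlocks hτ hf ht hN k)

lemma blockKernel_apply (D : Model I N) (k : Fin 2) (θ : State I) :
    D.blockKernel k θ = (condDistrib (fun θ : State I => (θ.1, θ.2 k))
      (fun θ : State I => θ.2 k.rev) D.posterior (θ.2 k.rev)).map
        fun u => assemble k u (θ.2 k.rev) := by
  rw [blockKernel, Kernel.map_apply _ (measurable_assemble k), Kernel.comap_apply,
    Kernel.prod_apply, Kernel.id_apply, Measure.prod_dirac,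
    Measure.map_map (measurable_assemble k) (by fun_prop)]
  rfl

lemma measurable_assemble_left (k : Fin 2) (b : Fin I → ℝ) :
    Measurable fun u : ℝ × (Fin I → ℝ) => assemble k u b :=
  (measurable_assemble k).comp (measurable_id.prodMk measurable_const)

lemma blockKernel_ae_eq (D : Model I N) (hτ : 0 < D.τ)
    (hf : ∀ k, 0 < D.τf k) (ht : 0 ≤ D.tpr) (hN : 0 < N) (k : Fin 2) :
    ∀ᵐ θ ∂D.posterior, D.blockKernel k θ =
      (noiseLaw I).map fun z => assemble k (D.blockDraw k (θ.2 k.rev) z) (θ.2 k.rev) := by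
  have hpr : Measurable fun θ : State I => θ.2 k.rev := by fun_prop
  filter_upwards [ae_of_ae_map hpr.aemeasurable
    (D.condDistrib_ae_eq_drawKernel hτ hf ht hN k)] with θ hθ
  rw [blockKernel_apply, hθ, drawKernel_apply, Measure.map_map (measurable_assemble_left k _)
    (D.measurable_blockDraw k).of_uncurry_left]
  rfl

lemma programExact (D : Model I N) (hτ : 0 < D.τ)
    (hf : ∀ k, 0 < D.τf k) (ht : 0 ≤ D.tpr) (hN : 0 < N) : D.ProgramExact := by
  intro k
  filter_upwards [D.blockKernel_ae_eq hτ hf ht hN k] with θ hθ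
  rw [hθ]
  simp only [val_blockProgram]

end Model

/-! ### Operator norms from decay on a dense set -/

section Hilbert

open scoped InnerProductSpace

variable {E : Type*} [NormedAddCommGroup E] [InnerProductSpace ℝ E]

/-- The norms of the iterates of a symmetric operator are log-convex. -/
lemma norm_iterate_sq_le {S : E →L[ℝ] E} (hS : ∀ x y, ⟪S x, y⟫_ℝ = ⟪x, S y⟫_ℝ) (x : E) :
    ‖S x‖ ^ 2 ≤ ‖x‖ * ‖S (S x)‖ := by
  rw [← real_inner_self_eq_norm_sq, hS]
  exact real_inner_le_norm _ _

/-- If the iterates of a symmetric operator decay at rate `κ` on a dense set, then its norm is at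
most `κ`. -/
lemma norm_apply_le_of_dense_decay {S : E →L[ℝ] E} (hS : ∀ x y, ⟪S x, y⟫_ℝ = ⟪x, S y⟫_ℝ)
    {κ : ℝ} (hκ : 0 < κ) {A : Set E} (hA : Dense A)
    (h : ∀ x ∈ A, ∃ C : ℝ, ∀ t : ℕ, ‖(S ^ t) x‖ ≤ C * κ ^ t) (x : E) : ‖S x‖ ≤ κ * ‖x‖ := by
  have hcl : IsClosed {x : E | ‖S x‖ ≤ κ * ‖x‖} :=
    isClosed_le (by fun_prop) (by fun_prop)
  suffices hsub : A ⊆ {x : E | ‖S x‖ ≤ κ * ‖x‖} from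
    hcl.closure_subset_iff.2 hsub (hA x)
  intro x hx
  by_contra hlt
  simp only [Set.mem_ofPred_eq, not_le] at hlt
  obtain ⟨C, hC⟩ := h x hx
  have hx0 : 0 < ‖x‖ := by
    rw [norm_pos_iff]
    rintro rfl
    simp at hlt
  set q := ‖S x‖ / ‖x‖ with hq
  have hqκ : κ < q := (lt_div_iff₀ hx0).2 hlt
  have hq0 : 0 < q := hκ.trans hqκ
  have hsucc : ∀ (t : ℕ) (y : E), (S ^ (t + 1)) y = S ((S ^ t) y) := by
    intro t y; rw [pow_succ']; rfl
  -- Log-convexity makes the ratios of successive norms nondecreasing, so all of them are at least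
  -- the first ratio q. If q exceeded κ, growth like qᵗ would contradict the assumed decay.
  have key : ∀ t : ℕ, 0 < ‖(S ^ t) x‖ ∧ q * ‖(S ^ t) x‖ ≤ ‖(S ^ (t + 1)) x‖ := by
    intro t
    induction t with
    | zero =>
      refine ⟨by simpa using hx0, ?_⟩
      rw [hsucc, hq]
      simp [hx0.ne']
    | succ t ih =>
      obtain ⟨h0, h1⟩ := ih
      have h2 : 0 < ‖(S ^ (t + 1)) x‖ := lt_of_lt_of_le (mul_pos hq0 h0) h1
      refine ⟨h2, ?_⟩
      have h3 := norm_iterate_sq_le hS ((S ^ t) x)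
      rw [← hsucc, ← hsucc] at h3
      refine le_of_mul_le_mul_left ?_ h0
      nlinarith
  have hlow : ∀ t : ℕ, q ^ t * ‖x‖ ≤ ‖(S ^ t) x‖ := by
    intro t
    induction t with
    | zero => simp
    | succ t ih =>
      refine le_trans ?_ (key t).2
      rw [pow_succ', mul_assoc]
      gcongr
  have hbd : ∀ t : ℕ, (q / κ) ^ t ≤ C / ‖x‖ := by
    intro t
    rw [div_pow, div_le_div_iff₀ (by positivity) hx0]
    exact (hlow t).trans (hC t)
  obtain ⟨t, ht⟩ := pow_unbounded_of_one_lt (C / ‖x‖) ((one_lt_div hκ).2 hqκ)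
  exact absurd (hbd t) (not_le.2 ht)

/-- Convergence of alternating projections `(p₀ p₁)ᵗ` to the projection `e` on a common subspace,
from convergence on a dense set. -/
lemma alternating_projections_decay {p₀ p₁ e : E →L[ℝ] E}
    (hs₀ : ∀ x y, ⟪p₀ x, y⟫_ℝ = ⟪x, p₀ y⟫_ℝ) (hs₁ : ∀ x y, ⟪p₁ x, y⟫_ℝ = ⟪x, p₁ y⟫_ℝ)
    (hse : ∀ x y, ⟪e x, y⟫_ℝ = ⟪x, e y⟫_ℝ) (hi₀ : p₀ * p₀ = p₀) (he : e * e = e)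
    (he₀ : e * p₀ = e) (he₁ : e * p₁ = e) {κ : ℝ} (hκ : 0 < κ) {A : Set E} (hA : Dense A)
    (h : ∀ x ∈ A, ∃ C : ℝ, ∀ t : ℕ, ‖((p₀ * p₁) ^ t) (p₀ x) - e x‖ ≤ C * κ ^ t) (x : E) :
    ∃ C : ℝ, 0 ≤ C ∧ ∀ t : ℕ, ‖((p₀ * p₁) ^ t) x - e x‖ ≤ C * κ ^ t := by
  -- Taking adjoints of e p = e gives p e = e.
  have comm : ∀ p : E →L[ℝ] E, (∀ x y, ⟪p x, y⟫_ℝ = ⟪x, p y⟫_ℝ) → e * p = e → p * e = e := by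
    intro p hp hep
    ext x
    refine ext_inner_right ℝ fun y => ?_
    change ⟪p (e x), y⟫_ℝ = _
    rw [hp, hse, hse, ← mul_apply_eq_comp, hep]
  have h0e := comm p₀ hs₀ he₀
  have h1e := comm p₁ hs₁ he₁
  set R := p₀ * p₁ with hR
  have heR : ∀ t : ℕ, e * R ^ t = e := by
    intro t
    induction t with
    | zero => simp
    | succ t ih => rw [pow_succ, ← mul_assoc, ih, hR, ← mul_assoc, he₀, he₁]
  have h0R : ∀ t : ℕ, p₀ * R ^ (t + 1) = R ^ (t + 1) := by
    intro t
    rw [pow_succ', ← mul_assoc, hR, ← mul_assoc, hi₀]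
  set S := R * p₀ - e with hSdef
  -- The formula fails at exponent 0, where the left side is the identity and not p₀ - e; hence the
  -- shift, and the maximum with ‖x‖ in the decay bound below.
  have hSpow : ∀ t : ℕ, S ^ (t + 1) = R ^ (t + 1) * p₀ - e := by
    intro t
    induction t with
    | zero => simp [hSdef]
    | succ t ih =>
      have hRe : R * p₀ * e = e := by rw [mul_assoc, h0e, hR, mul_assoc, h1e, h0e]
      have h1 : R * p₀ * (R ^ (t + 1) * p₀) = R ^ (t + 2) * p₀ := by
        rw [mul_assoc R, ← mul_assoc p₀, h0R, ← mul_assoc, ← pow_succ']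
      have h2 : e * (R ^ (t + 1) * p₀) = e := by rw [← mul_assoc, heR, he₀]
      rw [pow_succ' S, ih, hSdef, sub_mul, mul_sub, mul_sub, hRe, h1, h2, he]
      simp
  have hSsym : ∀ x y, ⟪S x, y⟫_ℝ = ⟪x, S y⟫_ℝ := by
    intro x y
    change ⟪p₀ (p₁ (p₀ x)) - e x, y⟫_ℝ = ⟪x, p₀ (p₁ (p₀ y)) - e y⟫_ℝ
    rw [inner_sub_left, inner_sub_right, hs₀, hs₁, hs₀, hse]
  have hdec : ∀ x ∈ A, ∃ C : ℝ, ∀ t : ℕ, ‖(S ^ t) x‖ ≤ C * κ ^ t := by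
    intro x hx
    obtain ⟨C, hC⟩ := h x hx
    refine ⟨max C ‖x‖, fun t => ?_⟩
    rcases t with _ | t
    · simp
    · rw [hSpow]
      refine (hC (t + 1)).trans ?_
      gcongr
      exact le_max_left _ _
  have hSle := norm_apply_le_of_dense_decay hSsym hκ hA hdec
  have hSt : ∀ (t : ℕ) (y : E), ‖(S ^ t) y‖ ≤ κ ^ t * ‖y‖ := by
    intro t y
    induction t with
    | zero => simp
    | succ t ih =>
      rw [pow_succ' S, pow_succ', mul_assoc]
      exact (hSle _).trans (mul_le_mul_of_nonneg_left ih hκ.le)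
  -- The three terms serve t = 0, t = 1 and t ≥ 2. In the last case Rᵗ - e = Sᵗ⁻¹ p₁, which costs
  -- one factor κ.
  refine ⟨‖x - e x‖ + ‖R x - e x‖ / κ + ‖p₁ x‖ / κ, by positivity, fun t => ?_⟩
  rcases t with _ | _ | t
  · simp only [pow_zero, mul_one, one_apply_eq_self]
    have : 0 ≤ ‖R x - e x‖ / κ + ‖p₁ x‖ / κ := by positivity
    linarith
  · simp only [zero_add, pow_one]
    rw [add_mul, add_mul, div_mul_cancel₀ _ hκ.ne', div_mul_cancel₀ _ hκ.ne']
    have : 0 ≤ ‖x - e x‖ * κ + ‖p₁ x‖ := by positivity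
    linarith
  · have h1 : (R ^ (t + 1 + 1)) x - e x = (S ^ (t + 1)) (p₁ x) := by
      rw [hSpow]
      change (R ^ (t + 1 + 1)) x - e x = (R ^ (t + 1)) (R x) - (e * p₁) x
      rw [he₁, pow_succ R (t + 1)]
      rfl
    rw [h1]
    refine (hSt _ _).trans ?_
    rw [mul_comm, pow_succ κ (t + 1), ← mul_assoc, mul_right_comm, add_mul,
      div_mul_cancel₀ _ hκ.ne']
    gcongr
    exact le_add_of_nonneg_left (by positivity)

end Hilbert

namespace Model

variable {I N : ℕ}

/-! ### Contraction of the block draws -/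

lemma resSum_sub (D : Model I N) (k : Fin 2) (b b' : Fin I → ℝ) (i : Fin I) :
    D.resSum k b i - D.resSum k b' i =
      -∑ n with D.lev k n = i, (b (D.lev k.rev n) - b' (D.lev k.rev n)) := by
  rw [resSum, resSum, ← Finset.sum_sub_distrib, Finset.sum_filter, ← Finset.sum_neg_distrib]
  refine Finset.sum_congr rfl fun n _ => ?_
  split_ifs <;> ring

lemma sum_lev_eq (D : Model I N) {c : ℕ} (hocc : ∀ k i, D.occ k i = c) (k : Fin 2)
    (f : Fin I → ℝ) : ∑ n, f (D.lev k n) = c * ∑ j, f j := by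
  rw [D.sum_levels k fun _ i => f i, Finset.mul_sum]
  refine Finset.sum_congr rfl fun i _ => ?_
  rw [← hocc k i, occ, ← Finset.sum_filter, Finset.sum_const, nsmul_eq_mul]

/-- The contraction factor of the block update of factor `k` if all levels have `c`
observations. -/
noncomputable def blockRate (D : Model I N) (c : ℕ) (k : Fin 2) : ℝ :=
  D.τ * c / (D.τf k + D.τ * c)

/-- By balance the kept effects enter the mean of a⁽⁰⁾ through their sum only. The bound r I ≤ 1 is
an equality for the flat prior; a proper prior only shrinks r. -/
lemma globalMean_sub (D : Model I N) (hτ : 0 < D.τ) (hf : ∀ k, 0 < D.τf k) (ht : 0 ≤ D.tpr)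
    (hI : 0 < I) {c : ℕ} (hc : 0 < c) (hocc : ∀ k i, D.occ k i = c) (k : Fin 2) :
    ∃ r : ℝ, 0 ≤ r ∧ r * I ≤ 1 ∧ ∀ b b' : Fin I → ℝ,
      D.globalMean k b - D.globalMean k b' = -(r * ∑ j, (b j - b' j)) := by
  set w := D.τ * D.τf k / (D.τf k + D.τ * c) with hw
  have hfk := hf k
  have hw0 : 0 < w := by positivity
  have hwi : ∀ i, D.levelWeight k i = w := fun i => by rw [levelWeight, levelPrec, hocc]
  have hP : D.globalPrec k = D.tpr + I * (w * c) := by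
    simp [globalPrec, hwi, hocc]
  have hP0 : 0 < D.globalPrec k := by rw [hP]; positivity
  refine ⟨w * c / D.globalPrec k, by positivity, ?_, fun b b' => ?_⟩
  · rw [div_mul_eq_mul_div, div_le_one hP0, hP]
    nlinarith
  · rw [globalMean, globalMean, ← sub_div, add_sub_add_left_eq_sub, ← Finset.sum_sub_distrib]
    simp only [hwi, ← mul_sub, resSum_sub, ← Finset.mul_sum, Finset.sum_neg_distrib]
    have h1 : ∑ i, ∑ n with D.lev k n = i, (b (D.lev k.rev n) - b' (D.lev k.rev n)) =
        c * ∑ j, (b j - b' j) := by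
      rw [← D.sum_lev_eq hocc k.rev fun j => b j - b' j,
        D.sum_levels k fun n _ => b (D.lev k.rev n) - b' (D.lev k.rev n)]
      simp only [Finset.sum_filter]
    rw [h1]
    field_simp

/-- With the same noise for both starting points, the change in a level effect is -τ/v times the sum
over its observations of δ - r s: the redrawn a⁽⁰⁾ partially centres δ. Cauchy-Schwarz gives one
factor c, and counting each level of the other factor c times gives the second. -/
lemma blockDraw_sub (D : Model I N) (hτ : 0 < D.τ) (hf : ∀ k, 0 < D.τf k) (ht : 0 ≤ D.tpr)
    (hI : 0 < I) {c : ℕ} (hc : 0 < c) (hocc : ∀ k i, D.occ k i = c) (k : Fin 2)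
    (b b' : Fin I → ℝ) (z : Noise I) :
    ((D.blockDraw k b z).1 - (D.blockDraw k b' z).1) ^ 2 ≤ ∑ j, (b j - b' j) ^ 2 ∧
    ∑ i, ((D.blockDraw k b z).2 i - (D.blockDraw k b' z).2 i) ^ 2 ≤
      D.blockRate c k ^ 2 * ∑ j, (b j - b' j) ^ 2 := by
  obtain ⟨r, hr0, hr1, hr⟩ := D.globalMean_sub hτ hf ht hI hc hocc k
  set δ : Fin I → ℝ := fun j => b j - b' j with hδ
  set s := ∑ j, δ j with hs
  have hα : (D.blockDraw k b z).1 - (D.blockDraw k b' z).1 = -(r * s) := by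
    rw [← hr b b']; simp only [blockDraw]; ring
  have hs2 : s ^ 2 ≤ I * ∑ j, δ j ^ 2 := by
    simpa using sq_sum_le_card_mul_sum_sq (s := (Finset.univ : Finset (Fin I))) (f := δ)
  have hI1 : (1 : ℝ) ≤ I := by exact_mod_cast hI
  have hδ0 : 0 ≤ ∑ j, δ j ^ 2 := Finset.sum_nonneg fun _ _ => sq_nonneg _
  refine ⟨?_, ?_⟩
  · rw [hα]
    have h1 : r * r ≤ r * 1 := by
      gcongr
      nlinarith
    have h2 : (-(r * s)) ^ 2 = (r * r) * s ^ 2 := by ring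
    calc (-(r * s)) ^ 2 = (r * r) * s ^ 2 := h2
      _ ≤ (r * 1) * (I * ∑ j, δ j ^ 2) := by gcongr
      _ = (r * I) * ∑ j, δ j ^ 2 := by ring
      _ ≤ 1 * ∑ j, δ j ^ 2 := by gcongr
      _ = _ := one_mul _
  set v := D.τf k + D.τ * c with hv
  have hfk := hf k
  have hv0 : 0 < v := by positivity
  have hvi : ∀ i, D.levelPrec k i = v := fun i => by rw [levelPrec, hocc]
  set x : Fin I → ℝ := fun j => δ j - r * s with hx
  have hdiff : ∀ i, (D.blockDraw k b z).2 i - (D.blockDraw k b' z).2 i =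
      -(D.τ / v * ∑ n with D.lev k n = i, x (D.lev k.rev n)) := by
    intro i
    have h1 : ∑ n with D.lev k n = i, x (D.lev k.rev n) =
        ∑ n with D.lev k n = i, δ (D.lev k.rev n) - c * (r * s) := by
      rw [hx, Finset.sum_sub_distrib, Finset.sum_const, nsmul_eq_mul]
      congr 2
      exact_mod_cast hocc k i
    have h2 := D.resSum_sub k b b' i
    have h3 : (D.blockDraw k b z).2 i - (D.blockDraw k b' z).2 i =
        D.τ / v * ((D.resSum k b i - D.resSum k b' i) -
          c * ((D.blockDraw k b z).1 - (D.blockDraw k b' z).1)) := by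
      simp only [blockDraw, levelMean, hvi, hocc]
      ring
    rw [h3, hα, h1, h2]
    ring
  have hcs : ∀ i, (∑ n with D.lev k n = i, x (D.lev k.rev n)) ^ 2 ≤
      c * ∑ n with D.lev k n = i, x (D.lev k.rev n) ^ 2 := by
    intro i
    have := sq_sum_le_card_mul_sum_sq (s := Finset.univ.filter fun n => D.lev k n = i)
      (f := fun n => x (D.lev k.rev n))
    rwa [show (Finset.univ.filter fun n => D.lev k n = i).card = c from hocc k i] at this
  -- Partial centring does not increase the norm: the difference is -r s² (2 - r I), and r I ≤ 1.
  have hx2 : ∑ j, x j ^ 2 ≤ ∑ j, δ j ^ 2 := by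
    have h1 : ∑ j, x j ^ 2 = ∑ j, δ j ^ 2 - 2 * (r * s) * s + I * (r * s) ^ 2 := by
      have : ∀ j, x j ^ 2 = δ j ^ 2 - 2 * (r * s) * δ j + (r * s) ^ 2 := fun j => by
        simp only [hx]; ring
      rw [Finset.sum_congr rfl fun j _ => this j, Finset.sum_add_distrib, Finset.sum_sub_distrib,
        ← Finset.mul_sum, ← hs]
      simp
    have h2 : 0 ≤ r * s ^ 2 * (2 - r * I) := by
      apply mul_nonneg (by positivity); linarith
    nlinarith
  calc ∑ i, ((D.blockDraw k b z).2 i - (D.blockDraw k b' z).2 i) ^ 2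
      = (D.τ / v) ^ 2 * ∑ i, (∑ n with D.lev k n = i, x (D.lev k.rev n)) ^ 2 := by
        rw [Finset.mul_sum]
        exact Finset.sum_congr rfl fun i _ => by rw [hdiff]; ring
    _ ≤ (D.τ / v) ^ 2 * ∑ i, c * ∑ n with D.lev k n = i, x (D.lev k.rev n) ^ 2 := by
        gcongr with i
        exact hcs i
    _ = (D.τ / v) ^ 2 * (c * (c * ∑ j, x j ^ 2)) := by
        rw [← Finset.mul_sum, ← D.sum_lev_eq hocc k.rev fun j => x j ^ 2,
          D.sum_levels k fun n _ => x (D.lev k.rev n) ^ 2]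
        simp only [Finset.sum_filter]
    _ ≤ (D.τ / v) ^ 2 * (c * (c * ∑ j, δ j ^ 2)) := by gcongr
    _ = D.blockRate c k ^ 2 * ∑ j, δ j ^ 2 := by
        rw [blockRate]; ring

end Model

/-! ### Conditional expectations as projections -/

section Projection

variable {X : Type} {m m₁ m₂ m₀ : MeasurableSpace X} {μ : Measure X}

/-- Conditional expectation as an operator on `L²`. -/
noncomputable def l2Proj (μ : Measure X) (hm : m ≤ m₀) : Lp ℝ 2 μ →L[ℝ] Lp ℝ 2 μ :=
  (lpMeas ℝ ℝ m 2 μ).subtypeL ∘L condExpL2 ℝ ℝ hm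

lemma l2Proj_ae_eq [IsProbabilityMeasure μ] (hm : m ≤ m₀) (F : Lp ℝ 2 μ) : l2Proj μ hm F =ᵐ[μ] μ[F | m] := by
  have := (Lp.memLp F).condExpL2_ae_eq_condExp (𝕜 := ℝ) hm
  rwa [Lp.toLp_coeFn] at this

lemma inner_l2Proj (hm : m ≤ m₀) (F G : Lp ℝ 2 μ) :
    inner ℝ (l2Proj μ hm F) G = inner ℝ F (l2Proj μ hm G) :=
  inner_condExpL2_left_eq_right hm

lemma l2Proj_mul_of_le [IsProbabilityMeasure μ] (h₁₂ : m₁ ≤ m₂) (hm₂ : m₂ ≤ m₀) :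
    l2Proj μ (h₁₂.trans hm₂) * l2Proj μ hm₂ = l2Proj μ (h₁₂.trans hm₂) := by
  ext1 F
  refine Lp.ext ?_
  refine (l2Proj_ae_eq _ _).trans (((condExp_congr_ae (l2Proj_ae_eq hm₂ F)).trans
    (condExp_condExp_of_le h₁₂ hm₂)).trans (l2Proj_ae_eq _ _).symm)

lemma l2Proj_bot_ae_eq [IsProbabilityMeasure μ] (F : Lp ℝ 2 μ) :
    l2Proj μ (bot_le : ⊥ ≤ m₀) F =ᵐ[μ] fun _ => ∫ x, F x ∂μ :=
  (l2Proj_ae_eq _ F).trans (by rw [condExp_bot])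

end Projection

namespace Model

variable {I N : ℕ}

/-! ### The transition operator of the sampler on `L²` -/

/-- The information kept by the block update of factor `k`. -/
abbrev keptSigma (I : ℕ) (k : Fin 2) : MeasurableSpace (State I) :=
  MeasurableSpace.comap (fun θ : State I => θ.2 k.rev) MeasurableSpace.pi

lemma measurable_kept (k : Fin 2) : Measurable fun θ : State I => θ.2 k.rev := by fun_prop

lemma keptSigma_le (k : Fin 2) : keptSigma I k ≤ Prod.instMeasurableSpace := (measurable_kept k).comap_le

instance (D : Model I N) (k : Fin 2) : IsMarkovKernel (D.blockKernel k) := by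
  unfold blockKernel
  exact Kernel.IsMarkovKernel.map _ (measurable_assemble k)

instance (D : Model I N) : IsMarkovKernel D.gibbsKernel := by
  unfold gibbsKernel
  infer_instance

lemma blockKernel_comp_posterior (D : Model I N) (k : Fin 2) :
    D.blockKernel k ∘ₘ D.posterior = D.posterior := by
  refine Measure.ext_of_lintegral _ fun F hF => ?_
  have hFa : Measurable fun x : (Fin I → ℝ) × (ℝ × (Fin I → ℝ)) => F (assemble k x.2 x.1) :=
    hF.comp ((measurable_assemble k).comp measurable_swap)
  rw [Measure.lintegral_bind (D.blockKernel k).aemeasurable hF.aemeasurable]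
  have h1 : ∀ θ, ∫⁻ y, F y ∂(D.blockKernel k θ) =
      (fun b => ∫⁻ u, F (assemble k u b) ∂(condDistrib (fun θ : State I => (θ.1, θ.2 k))
        (fun θ : State I => θ.2 k.rev) D.posterior b)) (θ.2 k.rev) := by
    intro θ
    rw [blockKernel_apply, lintegral_map hF (measurable_assemble_left k _)]
  rw [lintegral_congr h1, ← lintegral_map (hFa.lintegral_kernel_prod_right') (measurable_kept k),
    ← Measure.lintegral_compProd hFa, compProd_map_condDistrib (by fun_prop),
    lintegral_map hFa (by fun_prop)]
  simp only [assemble_toBlocks]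

lemma gibbsKernel_comp_posterior (D : Model I N) :
    D.gibbsKernel ∘ₘ D.posterior = D.posterior := by
  rw [gibbsKernel, ← Measure.comp_assoc, blockKernel_comp_posterior, blockKernel_comp_posterior]

/-- A block update averages over the conditional law given the kept effects, so on L² it is a
conditional expectation, hence an orthogonal projection. -/
lemma integral_blockKernel_ae_eq (D : Model I N) [IsProbabilityMeasure D.posterior] (k : Fin 2)
    (F : Lp ℝ 2 D.posterior) {g : State I → ℝ} (hg : g =ᵐ[D.posterior] F) :
    (fun θ => ∫ y, g y ∂(D.blockKernel k θ)) =ᵐ[D.posterior]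
      l2Proj D.posterior (keptSigma_le k) F := by
  have hF : StronglyMeasurable (F : State I → ℝ) := Lp.stronglyMeasurable F
  have hFi : Integrable (F : State I → ℝ) D.posterior := (Lp.memLp F).integrable one_le_two
  -- Invariance of the posterior makes the choice of representative harmless: a null set stays null
  -- for the kernel started at almost every θ.
  have hgB : ∀ᵐ θ ∂D.posterior, g =ᵐ[D.blockKernel k θ] F := by
    apply Measure.ae_ae_of_ae_comp
    rwa [blockKernel_comp_posterior]
  have hFa : StronglyMeasurable fun x : (Fin I → ℝ) × (ℝ × (Fin I → ℝ)) =>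
      F (assemble k x.2 x.1) :=
    hF.comp_measurable ((measurable_assemble k).comp measurable_swap)
  have hc := condExp_prod_ae_eq_integral_condDistrib (μ := D.posterior)
    (X := fun θ : State I => θ.2 k.rev) (Y := fun θ : State I => (θ.1, θ.2 k))
    (measurable_kept k) (by fun_prop) hFa (by simpa only [assemble_toBlocks] using hFi)
  simp only [assemble_toBlocks] at hc
  filter_upwards [hgB, hc, l2Proj_ae_eq (keptSigma_le k) F] with θ h1 h2 h3
  rw [integral_congr_ae h1, h3, blockKernel_apply,
    integral_map (measurable_assemble_left k _).aemeasurable hF.aestronglyMeasurable]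
  exact h2.symm

/-- The operator of one iteration of the sampler. -/
noncomputable def gibbsOp (D : Model I N) : Lp ℝ 2 D.posterior →L[ℝ] Lp ℝ 2 D.posterior :=
  l2Proj D.posterior (keptSigma_le 0) * l2Proj D.posterior (keptSigma_le 1)

lemma integral_gibbsKernel_ae_eq (D : Model I N) [IsProbabilityMeasure D.posterior]
    (F : Lp ℝ 2 D.posterior) {g : State I → ℝ} (hg : g =ᵐ[D.posterior] F) :
    (fun θ => ∫ y, g y ∂(D.gibbsKernel θ)) =ᵐ[D.posterior] D.gibbsOp F := by
  have hgi : Integrable g (D.gibbsKernel ∘ₘ D.posterior) := by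
    rw [gibbsKernel_comp_posterior]
    exact ((Lp.memLp F).integrable one_le_two).congr hg.symm
  have h1 := D.integral_blockKernel_ae_eq 1 F hg
  have h2 := D.integral_blockKernel_ae_eq 0 _ h1
  -- Block 0 is redrawn first, so its integral is the outer one, and the projection of block 0
  -- stands on the left.
  filter_upwards [h2, Measure.ae_integrable_of_integrable_comp hgi] with θ h3 h4
  rw [gibbsOp]
  change _ = (l2Proj D.posterior (keptSigma_le 0) (l2Proj D.posterior (keptSigma_le 1) F)) θ
  rw [← h3]
  exact Kernel.integral_comp h4

lemma kernelIter_ae_eq (D : Model I N) [IsProbabilityMeasure D.posterior]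
    {f : State I → ℝ} (hf : MemLp f 2 D.posterior) (t : ℕ) :
    kernelIter D.gibbsKernel f t =ᵐ[D.posterior] (D.gibbsOp ^ t) (hf.toLp f) := by
  induction t with
  | zero => exact hf.coeFn_toLp.symm
  | succ t ih =>
    have h := D.integral_gibbsKernel_ae_eq _ ih
    rw [pow_succ']
    refine Filter.EventuallyEq.trans (Filter.Eventually.of_forall fun θ => ?_) h
    simp only [kernelIter, Function.iterate_succ_apply']

/-! ### Smoothing by the block updates -/

/-- Euclidean distance of the effects of factor `l`. -/
noncomputable def effectDist (l : Fin 2) (θ θ' : State I) : ℝ :=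
  √(∑ j, (θ.2 l j - θ'.2 l j) ^ 2)

/-- Average of `g` over the block program of factor `k`. -/
noncomputable def blockAverage (D : Model I N) (k : Fin 2) (g : State I → ℝ) (θ : State I) : ℝ :=
  ∫ z, g (assemble k (D.blockDraw k (θ.2 k.rev) z) (θ.2 k.rev)) ∂(noiseLaw I)

lemma measurable_program (D : Model I N) (k : Fin 2) :
    Measurable fun p : State I × Noise I =>
      assemble k (D.blockDraw k (p.1.2 k.rev) p.2) (p.1.2 k.rev) := by
  have h1 : Measurable fun p : State I × Noise I => p.1.2 k.rev :=
    (measurable_kept k).comp measurable_fst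
  exact (measurable_assemble k).comp
    (((D.measurable_blockDraw k).comp (h1.prodMk measurable_snd)).prodMk h1)

lemma measurable_program_right (D : Model I N) (k : Fin 2) (θ : State I) :
    Measurable fun z : Noise I => assemble k (D.blockDraw k (θ.2 k.rev) z) (θ.2 k.rev) :=
  (measurable_assemble_left k _).comp (D.measurable_blockDraw k).of_uncurry_left

lemma measurable_blockAverage (D : Model I N) (k : Fin 2) {g : State I → ℝ} (hg : Measurable g) :
    Measurable (D.blockAverage k g) := by
  have h : StronglyMeasurable fun p : State I × Noise I =>
      g (assemble k (D.blockDraw k (p.1.2 k.rev) p.2) (p.1.2 k.rev)) :=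
    (hg.comp (D.measurable_program k)).stronglyMeasurable
  exact (h.integral_prod_right' (ν := noiseLaw I)).measurable

lemma integrable_program (D : Model I N) (k : Fin 2) {g : State I → ℝ} (hg : Measurable g)
    {B : ℝ} (hB : ∀ θ, |g θ| ≤ B) (θ : State I) :
    Integrable (fun z => g (assemble k (D.blockDraw k (θ.2 k.rev) z) (θ.2 k.rev)))
      (noiseLaw I) :=
  Integrable.of_bound (hg.comp (D.measurable_program_right k θ)).aestronglyMeasurable B
    (Filter.Eventually.of_forall fun _ => hB _)

lemma abs_blockAverage_le (D : Model I N) (k : Fin 2) {g : State I → ℝ}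
    {B : ℝ} (hB : ∀ θ, |g θ| ≤ B) (θ : State I) : |D.blockAverage k g θ| ≤ B := by
  have := norm_integral_le_of_norm_le_const (μ := noiseLaw I) (C := B)
    (f := fun z => g (assemble k (D.blockDraw k (θ.2 k.rev) z) (θ.2 k.rev)))
    (Filter.Eventually.of_forall fun _ => hB _)
  simpa [blockAverage] using this

lemma abs_blockAverage_sub_le (D : Model I N) (k : Fin 2) {g : State I → ℝ} (hg : Measurable g)
    {B : ℝ} (hB : ∀ θ, |g θ| ≤ B) {K : ℝ} (θ θ' : State I)
    (hK : ∀ z, |g (assemble k (D.blockDraw k (θ.2 k.rev) z) (θ.2 k.rev)) -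
      g (assemble k (D.blockDraw k (θ'.2 k.rev) z) (θ'.2 k.rev))| ≤ K) :
    |D.blockAverage k g θ - D.blockAverage k g θ'| ≤ K := by
  rw [blockAverage, blockAverage, ← integral_sub (D.integrable_program k hg hB θ)
    (D.integrable_program k hg hB θ')]
  have := norm_integral_le_of_norm_le_const (μ := noiseLaw I) (C := K)
    (f := fun z => g (assemble k (D.blockDraw k (θ.2 k.rev) z) (θ.2 k.rev)) -
      g (assemble k (D.blockDraw k (θ'.2 k.rev) z) (θ'.2 k.rev)))
    (Filter.Eventually.of_forall hK)
  simpa using this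

lemma l2Proj_ae_eq_blockAverage (D : Model I N) (hτ : 0 < D.τ) (hf : ∀ k, 0 < D.τf k)
    (ht : 0 ≤ D.tpr) (hN : 0 < N) [IsProbabilityMeasure D.posterior] (k : Fin 2)
    (F : Lp ℝ 2 D.posterior) {g : State I → ℝ} (hg : Measurable g) (hgF : F =ᵐ[D.posterior] g) :
    l2Proj D.posterior (keptSigma_le k) F =ᵐ[D.posterior] D.blockAverage k g := by
  refine (D.integral_blockKernel_ae_eq k F hgF.symm).symm.trans ?_
  filter_upwards [D.blockKernel_ae_eq hτ hf ht hN k] with θ hθ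
  rw [hθ, integral_map (D.measurable_program_right k θ).aemeasurable
    hg.stronglyMeasurable.aestronglyMeasurable]
  rfl

lemma assemble_snd_self (k : Fin 2) (u : ℝ × (Fin I → ℝ)) (b : Fin I → ℝ) :
    (assemble k u b).2 k = u.2 := by
  simp [assemble]

lemma blockRate_pos (D : Model I N) (hτ : 0 < D.τ) (hf : ∀ k, 0 < D.τf k) {c : ℕ} (hc : 0 < c)
    (k : Fin 2) : 0 < D.blockRate c k := by
  have := hf k
  unfold blockRate
  positivity

lemma blockRate_le_one (D : Model I N) (hτ : 0 < D.τ) (hf : ∀ k, 0 < D.τf k) (c : ℕ)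
    (k : Fin 2) : D.blockRate c k ≤ 1 := by
  have := hf k
  unfold blockRate
  rw [div_le_one (by positivity)]
  linarith

lemma blockAverage_contraction (D : Model I N) (hτ : 0 < D.τ) (hf : ∀ k, 0 < D.τf k)
    (ht : 0 ≤ D.tpr) (hI : 0 < I) {c : ℕ} (hc : 0 < c) (hocc : ∀ k i, D.occ k i = c) (k : Fin 2)
    {g : State I → ℝ} (hg : Measurable g) {B : ℝ} (hB : ∀ θ, |g θ| ≤ B) {K : ℝ} (hK : 0 ≤ K)
    (hgK : ∀ θ θ', |g θ - g θ'| ≤ K * effectDist k θ θ') (θ θ' : State I) :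
    |D.blockAverage k g θ - D.blockAverage k g θ'| ≤
      D.blockRate c k * K * effectDist k.rev θ θ' := by
  refine D.abs_blockAverage_sub_le k hg hB θ θ' fun z => (hgK _ _).trans ?_
  rw [mul_comm (D.blockRate c k) K, mul_assoc]
  gcongr
  simp only [effectDist, assemble_snd_self]
  refine (Real.sqrt_le_sqrt
    (D.blockDraw_sub hτ hf ht hI hc hocc k (θ.2 k.rev) (θ'.2 k.rev) z).2).trans_eq ?_
  rw [Real.sqrt_mul (sq_nonneg _), Real.sqrt_sq (D.blockRate_pos hτ hf hc k).le]

/-- Entry into the contraction scheme: one update turns a function that is Lipschitz in the whole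
state, a⁽⁰⁾ included, into one that is Lipschitz in the kept effects alone. This is what the bound
on the first component in `blockDraw_sub` is for. -/
lemma blockAverage_lipschitz (D : Model I N) (hτ : 0 < D.τ) (hf : ∀ k, 0 < D.τf k)
    (ht : 0 ≤ D.tpr) (hI : 0 < I) {c : ℕ} (hc : 0 < c) (hocc : ∀ k i, D.occ k i = c) (k : Fin 2)
    {g : State I → ℝ} (hg : Measurable g) {B : ℝ} (hB : ∀ θ, |g θ| ≤ B) {K : ℝ≥0}
    (hgK : LipschitzWith K g) (θ θ' : State I) :
    |D.blockAverage k g θ - D.blockAverage k g θ'| ≤ K * effectDist k.rev θ θ' := by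
  refine D.abs_blockAverage_sub_le k hg hB θ θ' fun z => ?_
  have h1 := hgK.dist_le_mul (assemble k (D.blockDraw k (θ.2 k.rev) z) (θ.2 k.rev))
    (assemble k (D.blockDraw k (θ'.2 k.rev) z) (θ'.2 k.rev))
  rw [Real.dist_eq] at h1
  refine h1.trans ?_
  gcongr
  obtain ⟨h2, h3⟩ := D.blockDraw_sub hτ hf ht hI hc hocc k (θ.2 k.rev) (θ'.2 k.rev) z
  have hnn : 0 ≤ effectDist k.rev θ θ' := Real.sqrt_nonneg _
  have hsq : ∀ x : ℝ, x ^ 2 ≤ ∑ j, (θ.2 k.rev j - θ'.2 k.rev j) ^ 2 →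
      |x| ≤ effectDist k.rev θ θ' := fun x hx => Real.abs_le_sqrt hx
  have h4 : ∑ i, ((D.blockDraw k (θ.2 k.rev) z).2 i - (D.blockDraw k (θ'.2 k.rev) z).2 i) ^ 2 ≤
      ∑ j, (θ.2 k.rev j - θ'.2 k.rev j) ^ 2 := by
    refine h3.trans (mul_le_of_le_one_left (Finset.sum_nonneg fun _ _ => sq_nonneg _) ?_)
    exact pow_le_one₀ (D.blockRate_pos hτ hf hc k).le (D.blockRate_le_one hτ hf c k)
  have hone : ∀ (x : Fin I → ℝ) (i : Fin I), x i ^ 2 ≤ ∑ j, x j ^ 2 := fun x i =>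
    Finset.single_le_sum (f := fun j => x j ^ 2) (fun _ _ => sq_nonneg _) (Finset.mem_univ i)
  rw [Prod.dist_eq, max_le_iff, dist_pi_le_iff hnn]
  refine ⟨by rw [Real.dist_eq]; exact hsq _ h2, fun l => ?_⟩
  rw [dist_pi_le_iff hnn]
  intro i
  rw [Real.dist_eq]
  apply hsq
  simp only [assemble]
  split_ifs
  · exact (hone (fun i => (D.blockDraw k (θ.2 k.rev) z).2 i -
      (D.blockDraw k (θ'.2 k.rev) z).2 i) i).trans h4
  · exact hone (fun j => θ.2 k.rev j - θ'.2 k.rev j) i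

/-! ### Rate of convergence of the sampler -/

lemma effectDist_eq_dist (l : Fin 2) (θ θ' : State I) :
    effectDist l θ θ' = dist (WithLp.toLp 2 (θ.2 l)) (WithLp.toLp 2 (θ'.2 l)) := by
  rw [EuclideanSpace.dist_eq]
  simp [effectDist, Real.dist_eq, sq_abs]

lemma effectDist_triangle (l : Fin 2) (θ θ' θ'' : State I) :
    effectDist l θ θ' ≤ effectDist l θ θ'' + effectDist l θ' θ'' := by
  simp only [effectDist_eq_dist]
  exact dist_triangle_right _ _ _

lemma effectDist_nonneg (l : Fin 2) (θ θ' : State I) : 0 ≤ effectDist l θ θ' :=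
  Real.sqrt_nonneg _

lemma memLp_effectDist (D : Model I N) (hτ : 0 < D.τ) (hf : ∀ k, 0 < D.τf k)
    (ht : 0 ≤ D.tpr) (hN : 0 < N) (l : Fin 2) :
    MemLp (fun θ : State I => effectDist l θ 0) 2 D.posterior := by
  have hm : Measurable fun θ : State I => effectDist l θ 0 := by
    unfold effectDist; fun_prop
  have hE : Integrable D.effectEnergy D.posterior := by
    refine ⟨D.measurable_effectEnergy.aestronglyMeasurable, ?_⟩
    rw [hasFiniteIntegral_iff_ofReal
      (Filter.Eventually.of_forall fun θ => D.effectEnergy_nonneg hf θ)]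
    exact D.lintegral_effectEnergy_posterior_lt_top hτ hf ht hN
  rw [memLp_two_iff_integrable_sq hm.aestronglyMeasurable]
  refine (hE.const_mul (D.τf l)⁻¹).mono' (hm.pow_const 2).aestronglyMeasurable
    (Filter.Eventually.of_forall fun θ => ?_)
  rw [Real.norm_of_nonneg (sq_nonneg _), effectDist,
    Real.sq_sqrt (Finset.sum_nonneg fun _ _ => sq_nonneg _)]
  have h1 : D.τf l * ∑ j, θ.2 l j ^ 2 ≤ D.effectEnergy θ := by
    rw [Finset.mul_sum]
    exact Finset.single_le_sum (f := fun k => ∑ i, D.τf k * θ.2 k i ^ 2)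
      (fun k _ => Finset.sum_nonneg fun i _ => mul_nonneg (hf k).le (sq_nonneg _))
      (Finset.mem_univ l)
  rw [le_inv_mul_iff₀ (hf l)]
  simpa using h1

/-- The bound on the rate of convergence if all levels have `c` observations. -/
noncomputable def gibbsRate (D : Model I N) (c : ℕ) : ℝ := D.blockRate c 0 * D.blockRate c 1

/-- The initial projection leaves a function controlled by factor 1 alone. Each iteration passes
through the two factors alternately, gains both block rates, and returns to a bound in factor 1. -/
lemma exists_lipschitz_iterate (D : Model I N) (hτ : 0 < D.τ) (hf : ∀ k, 0 < D.τf k)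
    (ht : 0 ≤ D.tpr) (hI : 0 < I) (hN : 0 < N) {c : ℕ} (hc : 0 < c)
    (hocc : ∀ k i, D.occ k i = c) [IsProbabilityMeasure D.posterior]
    {g : State I → ℝ} (hg : Measurable g) {B : ℝ} (hB : ∀ θ, |g θ| ≤ B) {K : ℝ≥0}
    (hgK : LipschitzWith K g) (F : Lp ℝ 2 D.posterior) (hFg : F =ᵐ[D.posterior] g) (t : ℕ) :
    ∃ h : State I → ℝ, Measurable h ∧ (∀ θ, |h θ| ≤ B) ∧
      (∀ θ θ', |h θ - h θ'| ≤ K * D.gibbsRate c ^ t * effectDist 1 θ θ') ∧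
      (D.gibbsOp ^ t) (l2Proj D.posterior (keptSigma_le 0) F) =ᵐ[D.posterior] h := by
  have hq := D.blockRate_pos hτ hf hc
  have hr : 0 < D.gibbsRate c := mul_pos (hq 0) (hq 1)
  induction t with
  | zero =>
    refine ⟨D.blockAverage 0 g, D.measurable_blockAverage 0 hg, D.abs_blockAverage_le 0 hB,
      fun θ θ' => ?_, D.l2Proj_ae_eq_blockAverage hτ hf ht hN 0 F hg hFg⟩
    rw [pow_zero, mul_one]
    exact D.blockAverage_lipschitz hτ hf ht hI hc hocc 0 hg hB hgK θ θ'
  | succ t ih =>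
    obtain ⟨h, hm, hb, hl, he⟩ := ih
    have hK0 : 0 ≤ K * D.gibbsRate c ^ t := by positivity
    have hm1 := D.measurable_blockAverage 1 hm
    have hb1 := D.abs_blockAverage_le 1 hb
    have hl1 := D.blockAverage_contraction hτ hf ht hI hc hocc 1 hm hb hK0 hl
    have hl0 := D.blockAverage_contraction hτ hf ht hI hc hocc 0 hm1 hb1
      (mul_nonneg (hq 1).le hK0) hl1
    refine ⟨D.blockAverage 0 (D.blockAverage 1 h), D.measurable_blockAverage 0 hm1,
      D.abs_blockAverage_le 0 hb1, fun θ θ' => ?_, ?_⟩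
    · refine (hl0 θ θ').trans_eq ?_
      rw [pow_succ]
      simp only [gibbsRate]
      change _ * effectDist 1 θ θ' = _
      ring
    · rw [pow_succ']
      exact D.l2Proj_ae_eq_blockAverage hτ hf ht hN 0 _ hm1
        (D.l2Proj_ae_eq_blockAverage hτ hf ht hN 1 _ hm he)

lemma l2Proj_bot_gibbsOp_pow (D : Model I N) [IsProbabilityMeasure D.posterior] (t : ℕ)
    (F : Lp ℝ 2 D.posterior) :
    l2Proj D.posterior bot_le ((D.gibbsOp ^ t) F) = l2Proj D.posterior bot_le F := by
  have h : ∀ (k : Fin 2) (G : Lp ℝ 2 D.posterior), l2Proj D.posterior bot_le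
      (l2Proj D.posterior (keptSigma_le k) G) = l2Proj D.posterior bot_le G := fun k G =>
    congrArg (fun T : Lp ℝ 2 D.posterior →L[ℝ] Lp ℝ 2 D.posterior => T G)
      (l2Proj_mul_of_le (bot_le : ⊥ ≤ keptSigma I k) (keptSigma_le k))
  induction t with
  | zero => rfl
  | succ t ih =>
    rw [pow_succ', ← ih]
    change l2Proj D.posterior bot_le (l2Proj D.posterior (keptSigma_le 0)
      (l2Proj D.posterior (keptSigma_le 1) _)) = _
    rw [h, h]
    rfl

/-- A small Lipschitz constant bounds the distance from the mean by a function that is square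
integrable under the posterior. Only distances of factor effects enter, so no moment of a⁽⁰⁾ is
needed. -/
lemma abs_sub_integral_le (D : Model I N) [IsProbabilityMeasure D.posterior]
    {l : Fin 2} (hdist : MemLp (fun θ : State I => effectDist l θ 0) 2 D.posterior)
    {h : State I → ℝ} (hh : Integrable h D.posterior) {K : ℝ} (hK : 0 ≤ K)
    (hl : ∀ θ θ', |h θ - h θ'| ≤ K * effectDist l θ θ') (θ : State I) :
    |h θ - ∫ θ', h θ' ∂D.posterior| ≤
      K * (effectDist l θ 0 + ∫ θ', effectDist l θ' 0 ∂D.posterior) := by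
  have hdi : Integrable (fun θ : State I => effectDist l θ 0) D.posterior :=
    hdist.integrable one_le_two
  have h1 : h θ - ∫ θ', h θ' ∂D.posterior = ∫ θ', (h θ - h θ') ∂D.posterior := by
    rw [integral_sub (integrable_const _) hh]
    simp
  have h2 : ∫ θ', K * (effectDist l θ 0 + effectDist l θ' 0) ∂D.posterior =
      K * (effectDist l θ 0 + ∫ θ', effectDist l θ' 0 ∂D.posterior) := by
    rw [integral_const_mul, integral_add (integrable_const _) hdi]
    simp
  rw [h1, ← h2, ← Real.norm_eq_abs]
  refine norm_integral_le_of_norm_le (((integrable_const _).add hdi).const_mul K)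
    (Filter.Eventually.of_forall fun θ' => (hl θ θ').trans ?_)
  gcongr
  exact effectDist_triangle l θ θ' 0

lemma gibbsOp_decay_smooth (D : Model I N) (hτ : 0 < D.τ) (hf : ∀ k, 0 < D.τf k)
    (ht : 0 ≤ D.tpr) (hI : 0 < I) (hN : 0 < N) {c : ℕ} (hc : 0 < c)
    (hocc : ∀ k i, D.occ k i = c) [IsProbabilityMeasure D.posterior]
    {g : State I → ℝ} (hgs : HasCompactSupport g) (hgd : ContDiff ℝ (⊤ : ℕ∞) g)
    (F : Lp ℝ 2 D.posterior) (hFg : F =ᵐ[D.posterior] g) :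
    ∃ C : ℝ, ∀ t : ℕ, ‖(D.gibbsOp ^ t) (l2Proj D.posterior (keptSigma_le 0) F) -
      l2Proj D.posterior bot_le F‖ ≤ C * D.gibbsRate c ^ t := by
  obtain ⟨B, hB⟩ := hgs.exists_bound_of_continuous hgd.continuous
  obtain ⟨K, hK⟩ := ContDiff.lipschitzWith_of_hasCompactSupport hgs hgd (by simp)
  have hq := D.blockRate_pos hτ hf hc
  have hr : 0 < D.gibbsRate c := mul_pos (hq 0) (hq 1)
  have hdist := D.memLp_effectDist hτ hf ht hN 1
  have hW : MemLp (fun θ : State I => effectDist 1 θ 0 +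
      ∫ θ', effectDist 1 θ' 0 ∂D.posterior) 2 D.posterior := hdist.add (memLp_const _)
  refine ⟨K * ‖hW.toLp _‖, fun t => ?_⟩
  obtain ⟨h, hm, hb, hl, he⟩ := D.exists_lipschitz_iterate hτ hf ht hI hN hc hocc
    hgd.continuous.measurable hB hK F hFg t
  have hhi : Integrable h D.posterior :=
    Integrable.of_bound hm.aestronglyMeasurable B (Filter.Eventually.of_forall hb)
  -- The iterates keep the mean of F, so they may be compared with their own mean.
  have hbot : l2Proj D.posterior bot_le F = l2Proj D.posterior bot_le
      ((D.gibbsOp ^ t) (l2Proj D.posterior (keptSigma_le 0) F)) := by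
    rw [l2Proj_bot_gibbsOp_pow]
    exact (congrArg (fun T : Lp ℝ 2 D.posterior →L[ℝ] Lp ℝ 2 D.posterior => T F)
      (l2Proj_mul_of_le (bot_le : ⊥ ≤ keptSigma I 0) (keptSigma_le 0))).symm
  rw [hbot, mul_right_comm]
  set Y := (D.gibbsOp ^ t) (l2Proj D.posterior (keptSigma_le 0) F)
  refine Lp.norm_le_mul_norm_of_ae_le_mul ?_
  filter_upwards [Lp.coeFn_sub Y (l2Proj D.posterior bot_le Y), he, l2Proj_bot_ae_eq Y,
    hW.coeFn_toLp] with θ h1 h2 h3 h4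
  rw [h1, Pi.sub_apply, h2, h3, integral_congr_ae he, h4, Real.norm_eq_abs,
    Real.norm_of_nonneg (add_nonneg (effectDist_nonneg _ _ _)
      (integral_nonneg fun _ => effectDist_nonneg _ _ _))]
  exact D.abs_sub_integral_le hdist hhi (by positivity) hl θ

lemma gibbsOp_decay (D : Model I N) (hτ : 0 < D.τ) (hf : ∀ k, 0 < D.τf k)
    (ht : 0 ≤ D.tpr) (hI : 0 < I) (hN : 0 < N) {c : ℕ} (hc : 0 < c)
    (hocc : ∀ k i, D.occ k i = c) [IsProbabilityMeasure D.posterior] (F : Lp ℝ 2 D.posterior) :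
    ∃ C : ℝ, 0 ≤ C ∧ ∀ t : ℕ, ‖(D.gibbsOp ^ t) F - l2Proj D.posterior bot_le F‖ ≤
      C * D.gibbsRate c ^ t := by
  have hq := D.blockRate_pos hτ hf hc
  refine alternating_projections_decay (inner_l2Proj _) (inner_l2Proj _) (inner_l2Proj _)
    (l2Proj_mul_of_le le_rfl (keptSigma_le 0)) (l2Proj_mul_of_le le_rfl bot_le)
    (l2Proj_mul_of_le (bot_le : ⊥ ≤ keptSigma I 0) (keptSigma_le 0))
    (l2Proj_mul_of_le (bot_le : ⊥ ≤ keptSigma I 1) (keptSigma_le 1))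
    (mul_pos (hq 0) (hq 1))
    (Lp.dense_hasCompactSupport_contDiff (F := ℝ) (μ := D.posterior) (p := 2) (by simp)) ?_ F
  rintro G ⟨g, hGg, hgs, hgd⟩
  exact D.gibbsOp_decay_smooth hτ hf ht hI hN hc hocc hgs hgd G hGg

lemma l2Rate_gibbsKernel_le (D : Model I N) (hτ : 0 < D.τ) (hf : ∀ k, 0 < D.τf k)
    (ht : 0 ≤ D.tpr) (hI : 0 < I) (hN : 0 < N) {c : ℕ} (hc : 0 < c)
    (hocc : ∀ k i, D.occ k i = c) :
    l2Rate D.gibbsKernel D.posterior ≤ ENNReal.ofReal (D.gibbsRate c) := by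
  have := D.isProbabilityMeasure_posterior hτ hf ht hN
  have hq := D.blockRate_pos hτ hf hc
  have hr : 0 < D.gibbsRate c := mul_pos (hq 0) (hq 1)
  refine sInf_le ⟨(D.gibbsRate c).toNNReal, rfl, fun f hfm => ?_⟩
  obtain ⟨C, hC0, hC⟩ := D.gibbsOp_decay hτ hf ht hI hN hc hocc (hfm.toLp f)
  refine ⟨C.toNNReal, fun t => ?_⟩
  set Y := (D.gibbsOp ^ t) (hfm.toLp f)
  set Z := l2Proj D.posterior bot_le (hfm.toLp f)
  have h1 : (fun x => kernelIter D.gibbsKernel f t x - ∫ y, f y ∂D.posterior) =ᵐ[D.posterior]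
      (Y - Z : Lp ℝ 2 D.posterior) := by
    filter_upwards [Lp.coeFn_sub Y Z, D.kernelIter_ae_eq hfm t,
      l2Proj_bot_ae_eq (hfm.toLp f)] with θ h1 h2 h3
    rw [h1, Pi.sub_apply, h2, h3, integral_congr_ae hfm.coeFn_toLp]
  rw [eLpNorm_congr_ae h1, ← Lp.enorm_def, ← ofReal_norm]
  refine (ENNReal.ofReal_le_ofReal (hC t)).trans_eq ?_
  rw [ENNReal.ofReal_mul hC0, ENNReal.ofReal_pow hr.le]
  rfl

lemma relaxationTime_gibbsKernel_le (D : Model I N) (hτ : 0 < D.τ) (hf : ∀ k, 0 < D.τf k)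
    (ht : 0 ≤ D.tpr) (hI : 0 < I) (hN : 0 < N) {c : ℕ} (hc : 0 < c)
    (hocc : ∀ k i, D.occ k i = c) :
    relaxationTime D.gibbsKernel D.posterior ≤
      ENNReal.ofReal ((D.τf 0 + D.τ * c) / D.τf 0) := by
  have hf0 := hf 0
  -- One of the two rates is given up: 1 - q_0 is already of order 1/c, which suffices.
  have hle : D.gibbsRate c ≤ D.blockRate c 0 :=
    mul_le_of_le_one_right (D.blockRate_pos hτ hf hc 0).le (D.blockRate_le_one hτ hf c 1)
  have hrate : l2Rate D.gibbsKernel D.posterior ≤ ENNReal.ofReal (D.blockRate c 0) :=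
    (D.l2Rate_gibbsKernel_le hτ hf ht hI hN hc hocc).trans (ENNReal.ofReal_le_ofReal hle)
  have hgap : 1 - D.blockRate c 0 = ((D.τf 0 + D.τ * c) / D.τf 0)⁻¹ := by
    rw [blockRate]
    field_simp
    ring
  rw [relaxationTime, ENNReal.inv_le_iff_inv_le, ← ENNReal.ofReal_inv_of_pos (by positivity),
    ← hgap, ENNReal.ofReal_sub _ (D.blockRate_pos hτ hf hc 0).le, ENNReal.ofReal_one]
  exact tsub_le_tsub_left hrate 1

lemma costGibbs_le (D : Model I N) (hτ : 0 < D.τ) (hf : ∀ k, 0 < D.τf k)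
    (ht : 0 ≤ D.tpr) (hI : 3 ≤ I) {c : ℕ} (hc : 3 ≤ c) (hocc : ∀ k i, D.occ k i = c) :
    D.costGibbs ≤ ENNReal.ofReal (10 * (1 + D.τ / D.τf 0) * (D.p * D.nbar ^ 2)) := by
  have hNc := D.card_obs_of_occ hocc
  have hN : 0 < N := by rw [hNc]; positivity
  have hf0 := hf 0
  rw [costGibbs, costPerIteration_eq]
  refine (mul_le_mul_right (D.relaxationTime_gibbsKernel_le hτ hf ht (by omega) hN (by omega)
    hocc) _).trans ?_
  rw [← ENNReal.ofReal_natCast, ← ENNReal.ofReal_mul (Nat.cast_nonneg _)]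
  apply ENNReal.ofReal_le_ofReal
  rw [D.nbar_of_occ (by omega) hocc, p]
  have hc' : (3 : ℝ) ≤ c := by exact_mod_cast hc
  have hI' : (3 : ℝ) ≤ I := by exact_mod_cast hI
  -- Here N = I c, and c ≥ 3, I ≥ 3 give 36 I ≤ 12 I c and 12 ≤ 2 I c.
  have h1 : ((2 * (3 * N + 18 * I + 6) : ℕ) : ℝ) ≤ 20 * (I * c) := by
    rw [hNc]; push_cast; nlinarith
  have h2 : (D.τf 0 + D.τ * c) / D.τf 0 ≤ (1 + D.τ / D.τf 0) * c := by
    have : (D.τf 0 + D.τ * c) / D.τf 0 = 1 + D.τ / D.τf 0 * c := by field_simp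
    rw [this, add_mul, one_mul]
    gcongr
    linarith
  calc _ ≤ 20 * (I * c) * ((1 + D.τ / D.τf 0) * c) := by gcongr
    _ = _ := by ring

end Model

end CrossedEffects

theorem mainTheorem6 :
    ∃ c C : ℝ, 0 < c ∧ 0 < C ∧
      ∀ (τ : ℝ) (τf : Fin 2 → ℝ), 0 < τ → (∀ k, 0 < τf k) →
        ∃ Cγ : ℝ, 0 < Cγ ∧
          ∀ (d I N : ℕ), 2 ≤ d → d + 1 ≤ I →
            ∀ D : CrossedEffects.Model I N,
              D.τ = τ → D.τf = τf → 0 ≤ D.tpr →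
              (∀ i j, D.cooc i j = CrossedEffects.worstDesign d I i j) →
                (D.BalancedLevels ∧ D.nbar = d + 1) ∧
                (c * (D.p * D.nbar) ≤ CrossedEffects.nQ D.precision ∧
                  CrossedEffects.nQ D.precision ≤ C * (D.p * D.nbar)) ∧
                (c * D.p ^ 2 ≤ CrossedEffects.nL D.precision ∧
                  CrossedEffects.nL D.precision ≤ C * D.p ^ 2) ∧
                (c * D.p ^ 3 ≤ CrossedEffects.costSLA D.precision ∧
                  CrossedEffects.costSLA D.precision ≤ C * D.p ^ 3) ∧
                D.ProgramExact ∧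
                D.costGibbs ≤ ENNReal.ofReal (Cγ * (D.p * D.nbar ^ 2)) := by
  refine ⟨1 / 200, 6, by norm_num, by norm_num, fun τ τf hτ hf => ?_⟩
  have hf0 := hf 0
  refine ⟨10 * (1 + τ / τf 0), by positivity, ?_⟩
  rintro d I N hd hI D rfl rfl ht hdes
  have hocc := D.occ_of_worstDesign hd hI hdes
  have hN : 0 < N := by rw [D.card_obs_of_occ hocc]; exact Nat.mul_pos (by omega) (by omega)
  obtain ⟨hQ, hL, hS⟩ := D.precision_sparsity hτ hd hI hdes
  refine ⟨⟨D.balancedLevels_of_occ (by omega) hocc, ?_⟩, hQ, hL, hS,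
    D.programExact hτ hf ht hN, D.costGibbs_le hτ hf ht (by omega) (by omega) hocc⟩
  rw [D.nbar_of_occ (by omega) hocc]
  push_cast
  rfl
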